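/- **Setting.** A range space $(\mathcal X,\mathcal R)$ consists of a finite set $\mathcal X$ with a probability measure $\mathrm P$ and a family $\mathcal R\subseteq 2^{\mathcal X}$ of (measurable) subsets. Its VC-dimension is the maximal size of a set $Y\subseteq\mathcal X$ with $\{R\cap Y: R\in\mathcal R\}=2^Y$. For $\epsilon>0$, an $\epsilon$-net is a set $S\subseteq \mathrm{supp}(\mathrm P)$ with $R\cap S\neq\emptyset$ for every $R\in\mathcal R$ with $\mathrm P(R)\ge\epsilon$. Put $\mathcal R_{\le t}:=\{R\in\mathcal R:\mathrm P(R)\le t\}$. Alexander's capacity is $$\tau(\epsilon):=\sup_{\epsilon_0\ge\epsilon}\frac{\mathrm P\big(\bigcup_{R\in\mathcal R_{\le\epsilon_0}}R\big)}{\epsilon_0},$$ and the doubling constant at scale $\epsilon$ is $\sup_{\epsilon_0\ge\epsilon}\mathcal M(\mathcal R_{\le 2\epsilon_0},\epsilon_0)$, where $\mathcal M(\mathcal R',t)$ is the maximal size of a subfamily $\mathcal Q\subseteq\mathcal R'$ with $\mathrm P(A\,\Delta\,B)\ge t$ for all distinct $A,B\in\mathcal Q$. **Theorem 4.** There are absolute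 constants $C,c>0$ such that the following holds. Let $(\mathcal X,\mathcal R)$ be a range space of VC-dimension at most $d$, let $\epsilon>0$, and let the real number $D_\epsilon$ be an upper bound on its doubling constant at scale $\epsilon$. Put $\tau_i:=\tau(2^i\epsilon)$ and $z:=1+\lceil\log_2\frac1\epsilon\rceil$. (i) If $D_\epsilon\ge 2\tau_1$, then there is an $\epsilon$-net for $(\mathcal X,\mathcal R)$ of size at most $$C\sum_{i=1}^{z}\Big(\log\frac{D_\epsilon}{\tau_i}+d\Big)\tau_i ,$$ where a term with $\tau_i=0$ is read as $0$. The same holds if $\tau$ is replaced throughout by $\max\{\tau,1\}$. (ii) If $d\ge1$ and $D_\epsilon\le\frac1{2\epsilon}$, then there is an $\epsilon$-net for $(\mathcal X,\mathcal R)$ of size at most $C\,dD_\epsilon\log\frac1{\epsilon D_\epsilon}$ (read as $0$ if $D_\epsilon=0$, which forces $\mathcal R=\emptyset$). Moreover, for all integers $n\ge1$, $d\ge0$ and all reals $\epsilon>d/n$ and $2\le D_\epsilon<\frac1{2\epsilon}$ there is a range space on $n$ points with the uniform measure, of VC-dimension at most $d$ and doubling constant at scale $\epsilon$ at most $D_\epsilon$,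 all of whose $\epsilon$-nets have size at least $c\,dD_\epsilon\log\frac1{\epsilon D_\epsilon}$. -/

import Mathlib

open MeasureTheory

/-!
A range space is a finite set `X` with a probability measure `P` and a finite family
`𝓡 : Finset (Finset X)` of ranges. Its VC-dimension is `𝓡.vcDim`.
-/

noncomputable section

namespace RangeSpace

variable {X : Type*} [DecidableEq X] [MeasurableSpace X]

/-- `S` is an `ε`-net: a set of points in the support of `P` (for a finite `X`, the points of
nonzero mass) that meets every range of measure at least `ε`. -/
def IsEpsNet (P : Measure X) (𝓡 : Finset (Finset X)) (ε : ℝ) (S : Finset X) : Prop :=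
  (∀ x ∈ S, P {x} ≠ 0) ∧ ∀ R ∈ 𝓡, ε ≤ P.real (R : Set X) → (R ∩ S).Nonempty

open Classical in
/-- The ranges of measure at most `t`. -/
def rangesLE (P : Measure X) (𝓡 : Finset (Finset X)) (t : ℝ) : Finset (Finset X) :=
  𝓡.filter fun R => P.real (R : Set X) ≤ t

/-- Alexander's capacity `τ(ε) = sup_{ε₀ ≥ ε} P(⋃ {R ∈ 𝓡 : P(R) ≤ ε₀}) / ε₀`, for `ε > 0`
(the supremum is over a nonempty set of numbers in `[0, 1 / ε]`). -/
def capacity (P : Measure X) (𝓡 : Finset (Finset X)) (ε : ℝ) : ℝ :=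
  sSup ((fun ε₀ : ℝ => P.real (⋃ R ∈ rangesLE P 𝓡 ε₀, (R : Set X)) / ε₀) '' Set.Ici ε)

/-- Alexander's capacity, cut off from below at the constant `1`. -/
def truncCapacity (P : Measure X) (𝓡 : Finset (Finset X)) (ε : ℝ) : ℝ :=
  max (capacity P 𝓡 ε) 1

/-- `𝓠` is `t`-separated for the distance `ρ(A, B) = P(A Δ B)`. -/
def IsPacking (P : Measure X) (t : ℝ) (𝓠 : Finset (Finset X)) : Prop :=
  ∀ A ∈ 𝓠, ∀ B ∈ 𝓠, A ≠ B → t ≤ P.real (symmDiff A B : Finset X)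

open Classical in
/-- The packing number: the largest size of a `t`-separated subfamily of `𝓡`. -/
def packingNumber (P : Measure X) (𝓡 : Finset (Finset X)) (t : ℝ) : ℕ :=
  (𝓡.powerset.filter fun 𝓠 => IsPacking P t 𝓠).sup Finset.card

/-- The doubling constant `sup_{ε₀ ≥ ε} M(𝓡_{≤ 2 ε₀}, ε₀)` (the supremum is over a nonempty set
of natural numbers bounded by the number of ranges). -/
def doublingConstant (P : Measure X) (𝓡 : Finset (Finset X)) (ε : ℝ) : ℕ :=
  sSup ((fun ε₀ : ℝ => packingNumber P (rangesLE P 𝓡 (2 * ε₀)) ε₀) '' Set.Ici ε)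

/-- The number `z = 1 + ⌈log₂ (1 / ε)⌉` of dyadic scales. It is negative or zero only for
`ε ≥ 2`, and a sum over `1 ≤ i ≤ z` is then empty. -/
def numScales (ε : ℝ) : ℕ :=
  (1 + ⌈Real.logb 2 (1 / ε)⌉).toNat

end RangeSpace

end

/-!
A range of measure at least `ε` lies in `[s, 2 s]` for one of the dyadic scales `s = 2 ^ (i - 1) ε`,
and the scales are treated separately. A maximal `s`-separated family of ranges of measure in
`[s, 2 s]` has at most `D` members, and every range of that measure contains at least a quarter of
some member. Draw `t (log (D / t) + d)` random points, up to a constant, from the union of the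
members, whose measure is at most `2 s t`. By the double sampling argument of Vapnik and
Chervonenkis, only `t exp (-d)` members are expected to contain a quarter of their measure in a
range that avoids the sample, and each of them is repaired by a net of `32 d + 1` points.

In (i) the measure of the union is bounded by the capacity. In (ii) it is bounded by the number of
members for scales below `1 / D`, and by the total mass `1` above, which makes the contributions of
the larger scales decay geometrically.

The matching example consists of disjoint blocks, `⌊D / 2⌋` of each of the sizes
`5 ^ i ⌈ε n⌉ + ⌊d / 2⌋`, with all subsets of size `5 ^ i ⌈ε n⌉` of a block as ranges: a net has to
contain more than `⌊d / 2⌋` points of each block.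
-/

namespace RangeSpace

open Finset

section VCDimension

variable {X : Type*} [DecidableEq X] {𝓑 : Finset (Finset X)} {d : ℕ}

/-- The traces on `Z` of the members of a set family, so that growth functions can be counted on
finite samples. -/
def traces (𝓑 : Finset (Finset X)) (Z : Finset X) : Finset (Finset X) :=
  𝓑.image (· ∩ Z)

lemma vcDim_traces_le (𝓑 : Finset (Finset X)) (Z : Finset X) : (traces 𝓑 Z).vcDim ≤ 𝓑.vcDim := by
  refine Finset.sup_le fun s hs => ?_
  rw [mem_shatterer] at hs
  have hsZ : s ⊆ Z := by
    obtain ⟨_, hT, hsT⟩ := hs.exists_superset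
    obtain ⟨B, -, rfl⟩ := mem_image.1 hT
    exact hsT.trans inter_subset_right
  refine Shatters.card_le_vcDim fun t ht => ?_
  obtain ⟨_, hT, rfl⟩ := hs ht
  obtain ⟨B, hB, rfl⟩ := mem_image.1 hT
  exact ⟨B, hB, by rw [inter_comm B, ← inter_assoc, inter_eq_left.2 hsZ]⟩

/-- The Sauer–Shelah bound, with the sum of binomial coefficients replaced by its generating
function so that it can be averaged over random sets `Z`. -/
lemma pow_mul_card_le_of_vcDim_le {Z : Finset X} {x : ℝ} (hZ : ∀ B ∈ 𝓑, B ⊆ Z)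
    (hd : 𝓑.vcDim ≤ d) (hx : 0 ≤ x) (hx1 : x ≤ 1) : x ^ d * #𝓑 ≤ (1 + x) ^ #Z := by
  have hsub : 𝓑.shatterer ⊆ Z.powerset := fun s hs => by
    obtain ⟨B, hB, hsB⟩ := (mem_shatterer.1 hs).exists_superset
    exact mem_powerset.2 (hsB.trans (hZ B hB))
  calc x ^ d * #𝓑 ≤ x ^ d * #𝓑.shatterer :=
        mul_le_mul_of_nonneg_left (by exact_mod_cast card_le_card_shatterer 𝓑) (by positivity)
    _ = ∑ _s ∈ 𝓑.shatterer, x ^ d := by rw [sum_const, nsmul_eq_mul, mul_comm]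
    _ ≤ ∑ s ∈ 𝓑.shatterer, x ^ #s := sum_le_sum fun s hs =>
        pow_le_pow_of_le_one hx hx1 ((mem_shatterer.1 hs).card_le_vcDim.trans hd)
    _ ≤ ∑ s ∈ Z.powerset, x ^ #s :=
        sum_le_sum_of_subset_of_nonneg hsub fun _ _ _ => by positivity
    _ = (1 + x) ^ #Z := by
        simpa only [one_pow, mul_one, add_comm] using Finset.sum_pow_mul_eq_add_pow x 1 Z

end VCDimension

section Samples

variable {X Y : Type*} {M : ℕ}

/-- The samples of `M` points of `U`, drawn with repetition. -/
def samples (U : Finset X) (M : ℕ) : Finset (Fin M → X) :=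
  Fintype.piFinset fun _ => U

/-- The product of the values of `φ` along a sample; for a weight `φ` on the points this is the
weight of the sample in the product measure. -/
def sampleProd (φ : X → ℝ) (f : Fin M → X) : ℝ :=
  ∏ j, φ (f j)

lemma mem_samples {U : Finset X} {f : Fin M → X} : f ∈ samples U M ↔ ∀ j, f j ∈ U :=
  Fintype.mem_piFinset

lemma sampleProd_nonneg {φ : X → ℝ} (hφ : ∀ a, 0 ≤ φ a) (f : Fin M → X) : 0 ≤ sampleProd φ f :=
  prod_nonneg fun _ _ => hφ _

lemma sampleProd_mul_sampleProd (φ ψ : X → ℝ) (f : Fin M → X) :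
    sampleProd φ f * sampleProd ψ f = sampleProd (fun a => φ a * ψ a) f :=
  prod_mul_distrib.symm

lemma sum_sampleProd (φ : X → ℝ) (U : Finset X) (M : ℕ) :
    ∑ f ∈ samples U M, sampleProd φ f = (∑ a ∈ U, φ a) ^ M :=
  (sum_pow' U φ M).symm

lemma sum_samples_sum_samples (U : Finset X) (V : Finset Y) (F : (Fin M → X × Y) → ℝ) :
    ∑ f ∈ samples U M, ∑ g ∈ samples V M, F (fun j => (f j, g j)) =
      ∑ z ∈ samples (U ×ˢ V) M, F z := by
  rw [← sum_product']
  refine sum_equiv (Equiv.arrowProdEquivProdArrow (Fin M) (fun _ => X) fun _ => Y).symm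
    (fun fg => ?_) fun _ _ => rfl
  simp only [mem_product, mem_samples, ← forall_and]
  rfl

/-- The permutation of the sequences of pairs that swaps the pairs at the indices where `σ` is
true. -/
def swapPairs (σ : Fin M → Bool) : (Fin M → X × X) ≃ (Fin M → X × X) :=
  Equiv.piCongrRight fun j => if σ j then Equiv.prodComm X X else Equiv.refl _

lemma swapPairs_apply (σ : Fin M → Bool) (z : Fin M → X × X) (j : Fin M) :
    swapPairs σ z j = if σ j then (z j).swap else z j := by
  simp only [swapPairs, Equiv.piCongrRight_apply, Pi.map_apply]
  split_ifs <;> rfl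

lemma sum_samples_swapPairs (U : Finset X) (σ : Fin M → Bool) (F : (Fin M → X × X) → ℝ) :
    ∑ z ∈ samples (U ×ˢ U) M, F (swapPairs σ z) = ∑ z ∈ samples (U ×ˢ U) M, F z := by
  refine sum_equiv (swapPairs σ) (fun z => ?_) fun _ _ => rfl
  simp only [mem_samples, swapPairs_apply]
  refine forall_congr' fun j => ?_
  split_ifs
  · rw [mem_product, mem_product, and_comm]; rfl
  · rfl

lemma sum_sampleProd_swapPairs_le {φ : X × X → ℝ} {c : ℝ} (hφ : ∀ z, 0 ≤ φ z)
    (hswap : ∀ z, φ z + φ z.swap ≤ c) (z : Fin M → X × X) :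
    ∑ σ : Fin M → Bool, sampleProd φ (swapPairs σ z) ≤ c ^ M := by
  calc ∑ σ : Fin M → Bool, sampleProd φ (swapPairs σ z)
      = ∏ j, ∑ s : Bool, φ (if s then (z j).swap else z j) := by
        rw [Fintype.prod_sum]
        simp only [sampleProd, swapPairs_apply]
    _ ≤ ∏ _j : Fin M, c := by
        refine prod_le_prod (fun j _ => sum_nonneg fun _ _ => hφ _) fun j _ => ?_
        rw [Fintype.sum_bool, add_comm]
        exact hswap (z j)
    _ = c ^ M := by rw [prod_const, card_univ, Fintype.card_fin]

/-- The weight of a pair of points in the product measure. -/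
def pairWeight (w : X → ℝ) (z : X × X) : ℝ :=
  w z.1 * w z.2

lemma pairWeight_nonneg (hw : ∀ a, 0 ≤ w a) (z : X × X) : 0 ≤ pairWeight w z :=
  mul_nonneg (hw _) (hw _)

lemma sampleProd_pairWeight_swapPairs (w : X → ℝ) (σ : Fin M → Bool) (z : Fin M → X × X) :
    sampleProd (pairWeight w) (swapPairs σ z) = sampleProd (pairWeight w) z := by
  refine prod_congr rfl fun j _ => ?_
  rw [swapPairs_apply]
  split_ifs
  · exact mul_comm _ _
  · rfl

end Samples

section DoubleSampling

variable {X : Type*} [DecidableEq X] {M : ℕ} {w : X → ℝ} {𝓑 : Finset (Finset X)} {U Q : Finset X}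
  {d : ℕ}

/-- The symmetrization functional of a set `B` on a pair consisting of a sample point and a ghost
point: it vanishes when the sample point lies in `B` and charges the ghost point a factor `2` for
lying in `B`. -/
def pairCharge (B : Finset X) (z : X × X) : ℝ :=
  if z.1 ∈ B then 0 else if z.2 ∈ B then 2 else 1

lemma pairCharge_nonneg (B : Finset X) (z : X × X) : 0 ≤ pairCharge B z := by
  unfold pairCharge
  split_ifs <;> norm_num

lemma pairCharge_add_swap_le (B : Finset X) (z : X × X) :
    pairCharge B z + pairCharge B z.swap ≤ 2 := by
  simp only [pairCharge, Prod.fst_swap, Prod.snd_swap]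
  split_ifs <;> norm_num

/-- The points that occur in a sequence of pairs. -/
def samplePoints (z : Fin M → X × X) : Finset X :=
  univ.biUnion fun j => {(z j).1, (z j).2}

lemma samplePoints_swapPairs (σ : Fin M → Bool) (z : Fin M → X × X) :
    samplePoints (swapPairs σ z) = samplePoints z := by
  refine biUnion_congr rfl fun j _ => ?_
  rw [swapPairs_apply]
  split_ifs
  · rw [Prod.fst_swap, Prod.snd_swap, pair_comm]
  · rfl

lemma sampleProd_pairCharge_inter_samplePoints (B : Finset X) (z : Fin M → X × X) :
    sampleProd (pairCharge (B ∩ samplePoints z)) z = sampleProd (pairCharge B) z := by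
  refine prod_congr rfl fun j _ => ?_
  have hmem : ∀ a ∈ ({(z j).1, (z j).2} : Finset X), (a ∈ B ∩ samplePoints z ↔ a ∈ B) :=
    fun a ha => by
      rw [mem_inter, and_iff_left]
      exact mem_biUnion.2 ⟨j, mem_univ j, ha⟩
  simp only [pairCharge, hmem _ (mem_insert_self _ _),
    hmem _ (mem_insert_of_mem (mem_singleton_self _))]

/-- The total charge of a double sample: only the finitely many traces of `𝓑` on its points
matter. -/
def traceCharge (𝓑 : Finset (Finset X)) (z : Fin M → X × X) : ℝ :=
  ∑ T ∈ traces 𝓑 (samplePoints z), sampleProd (pairCharge T) z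

lemma traceCharge_nonneg (𝓑 : Finset (Finset X)) (z : Fin M → X × X) : 0 ≤ traceCharge 𝓑 z :=
  sum_nonneg fun T _ => sampleProd_nonneg (pairCharge_nonneg T) z

lemma sampleProd_pairCharge_le_traceCharge {B : Finset X} (hB : B ∈ 𝓑) (z : Fin M → X × X) :
    sampleProd (pairCharge B) z ≤ traceCharge 𝓑 z := by
  rw [← sampleProd_pairCharge_inter_samplePoints B z]
  exact single_le_sum (f := fun T => sampleProd (pairCharge T) z)
    (fun T _ => sampleProd_nonneg (pairCharge_nonneg T) z) (mem_image_of_mem _ hB)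

lemma sum_mul_one_add_ite (w : X → ℝ) (hQ : Q ⊆ U) (x : ℝ) :
    ∑ a ∈ U, w a * (1 + if a ∈ Q then x else 0) = ∑ a ∈ U, w a + x * ∑ a ∈ Q, w a := by
  simp only [mul_add, mul_one, mul_ite, mul_zero, sum_add_distrib, sum_ite_mem,
    inter_eq_right.2 hQ, ← sum_mul, mul_comm x]

/-- If the sample `f` misses `B`, a ghost sample collects a factor `2` for each of its points in
`B`. -/
lemma sum_sampleProd_pairCharge_of_forall_notMem {B : Finset X} (hB : B ⊆ U) {f : Fin M → X}
    (hf : ∀ j, f j ∉ B) :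
    ∑ g ∈ samples U M, sampleProd w g * sampleProd (pairCharge B) (fun j => (f j, g j)) =
      (∑ a ∈ U, w a + ∑ a ∈ B, w a) ^ M := by
  have hcharge : ∀ g : Fin M → X, sampleProd (pairCharge B) (fun j => (f j, g j)) =
      sampleProd (fun a => 1 + if a ∈ B then 1 else 0) g := fun g => by
    refine prod_congr rfl fun j _ => ?_
    simp only [pairCharge, hf j, if_false]
    split_ifs <;> norm_num
  simp only [hcharge, sampleProd_mul_sampleProd, sum_sampleProd, sum_mul_one_add_ite w hB, one_mul]

lemma sum_sampleProd_mul_pow_le_sum_traceCharge (hw : ∀ a, 0 ≤ w a) (h𝓑 : ∀ B ∈ 𝓑, B ⊆ U) {p : ℝ}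
    (hp : 0 ≤ p) {F : Finset (Fin M → X)} (hFU : F ⊆ samples U M)
    (hF : ∀ f ∈ F, ∃ B ∈ 𝓑, p ≤ ∑ a ∈ B, w a ∧ ∀ j, f j ∉ B) :
    (∑ f ∈ F, sampleProd w f) * (∑ a ∈ U, w a + p) ^ M ≤
      ∑ z ∈ samples (U ×ˢ U) M, sampleProd (pairWeight w) z * traceCharge 𝓑 z := by
  have hghost : ∀ f ∈ F, (∑ a ∈ U, w a + p) ^ M ≤
      ∑ g ∈ samples U M, sampleProd w g * traceCharge 𝓑 (fun j => (f j, g j)) := fun f hf => by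
    obtain ⟨B, hB, hpB, hfB⟩ := hF f hf
    have hu : 0 ≤ ∑ a ∈ U, w a := sum_nonneg fun a _ => hw a
    calc (∑ a ∈ U, w a + p) ^ M ≤ (∑ a ∈ U, w a + ∑ a ∈ B, w a) ^ M := by gcongr
      _ = _ := (sum_sampleProd_pairCharge_of_forall_notMem (h𝓑 B hB) hfB).symm
      _ ≤ _ := sum_le_sum fun g _ => mul_le_mul_of_nonneg_left
        (sampleProd_pairCharge_le_traceCharge hB _) (sampleProd_nonneg hw g)
  calc (∑ f ∈ F, sampleProd w f) * (∑ a ∈ U, w a + p) ^ M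
      = ∑ f ∈ F, sampleProd w f * (∑ a ∈ U, w a + p) ^ M := sum_mul _ _ _
    _ ≤ ∑ f ∈ F, sampleProd w f *
          ∑ g ∈ samples U M, sampleProd w g * traceCharge 𝓑 (fun j => (f j, g j)) :=
        sum_le_sum fun f hf => mul_le_mul_of_nonneg_left (hghost f hf) (sampleProd_nonneg hw f)
    _ ≤ ∑ f ∈ samples U M, sampleProd w f *
          ∑ g ∈ samples U M, sampleProd w g * traceCharge 𝓑 (fun j => (f j, g j)) :=
        sum_le_sum_of_subset_of_nonneg hFU fun f _ _ => mul_nonneg (sampleProd_nonneg hw f)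
          (sum_nonneg fun g _ => mul_nonneg (sampleProd_nonneg hw g) (traceCharge_nonneg 𝓑 _))
    _ = ∑ f ∈ samples U M, ∑ g ∈ samples U M,
          sampleProd (pairWeight w) (fun j => (f j, g j)) *
            traceCharge 𝓑 (fun j => (f j, g j)) := by
        simp only [mul_sum, ← mul_assoc, sampleProd, pairWeight, prod_mul_distrib]
    _ = _ := sum_samples_sum_samples U U fun z => sampleProd (pairWeight w) z * traceCharge 𝓑 z

/-- Swapping a sample point with its ghost point preserves the weight and the traces, and averages
each charge to at most `1`. -/
lemma sum_traceCharge_le_sum_card_traces (hw : ∀ a, 0 ≤ w a) (U : Finset X)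
    (𝓑 : Finset (Finset X)) :
    ∑ z ∈ samples (U ×ˢ U) M, sampleProd (pairWeight w) z * traceCharge 𝓑 z ≤
      ∑ z ∈ samples (U ×ˢ U) M, sampleProd (pairWeight w) z * #(traces 𝓑 (samplePoints z)) := by
  have hswap (σ : Fin M → Bool) :
      ∑ z ∈ samples (U ×ˢ U) M, sampleProd (pairWeight w) z * traceCharge 𝓑 z =
        ∑ z ∈ samples (U ×ˢ U) M, sampleProd (pairWeight w) z *
          ∑ T ∈ traces 𝓑 (samplePoints z), sampleProd (pairCharge T) (swapPairs σ z) := by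
    rw [← sum_samples_swapPairs U σ]
    simp only [sampleProd_pairWeight_swapPairs, traceCharge, samplePoints_swapPairs]
  refine le_of_mul_le_mul_left (a := 2 ^ M) ?_ (by positivity)
  calc (2 : ℝ) ^ M * ∑ z ∈ samples (U ×ˢ U) M, sampleProd (pairWeight w) z * traceCharge 𝓑 z
      = ∑ σ : Fin M → Bool, ∑ z ∈ samples (U ×ˢ U) M, sampleProd (pairWeight w) z *
          ∑ T ∈ traces 𝓑 (samplePoints z), sampleProd (pairCharge T) (swapPairs σ z) := by
        simp only [← hswap, sum_const, card_univ, Fintype.card_pi, Fintype.card_bool, prod_const,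
          Fintype.card_fin, nsmul_eq_mul, Nat.cast_pow, Nat.cast_ofNat]
    _ = ∑ z ∈ samples (U ×ˢ U) M, sampleProd (pairWeight w) z *
          ∑ T ∈ traces 𝓑 (samplePoints z),
            ∑ σ : Fin M → Bool, sampleProd (pairCharge T) (swapPairs σ z) := by
        rw [sum_comm]
        refine sum_congr rfl fun z _ => ?_
        rw [← mul_sum, sum_comm]
    _ ≤ ∑ z ∈ samples (U ×ˢ U) M, sampleProd (pairWeight w) z *
          ∑ _T ∈ traces 𝓑 (samplePoints z), (2 : ℝ) ^ M :=
        sum_le_sum fun z _ => mul_le_mul_of_nonneg_left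
          (sum_le_sum fun T _ => sum_sampleProd_swapPairs_le (pairCharge_nonneg T)
            (pairCharge_add_swap_le T) z)
          (sampleProd_nonneg (pairWeight_nonneg hw) z)
    _ = 2 ^ M * ∑ z ∈ samples (U ×ˢ U) M,
          sampleProd (pairWeight w) z * #(traces 𝓑 (samplePoints z)) := by
        rw [mul_sum]
        refine sum_congr rfl fun z _ => ?_
        rw [sum_const, nsmul_eq_mul]
        ring

lemma card_pair_inter_le (a b : X) (Q : Finset X) :
    #({a, b} ∩ Q) ≤ (if a ∈ Q then 1 else 0) + if b ∈ Q then 1 else 0 := by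
  rw [insert_eq, union_inter_distrib_right]
  refine (card_union_le _ _).trans_eq ?_
  simp only [singleton_inter, apply_ite card, card_singleton, card_empty]

lemma one_add_pow_card_samplePoints_inter_le {x : ℝ} (hx : 0 ≤ x) (Q : Finset X)
    (z : Fin M → X × X) :
    (1 + x) ^ #(samplePoints z ∩ Q) ≤ sampleProd
      (pairWeight fun a => 1 + if a ∈ Q then x else 0) z := by
  have hx1 : 1 ≤ 1 + x := by linarith
  calc (1 + x) ^ #(samplePoints z ∩ Q)
      ≤ (1 + x) ^ ∑ j, #({(z j).1, (z j).2} ∩ Q) := by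
        rw [samplePoints, biUnion_inter]
        exact pow_le_pow_right₀ hx1 card_biUnion_le
    _ = ∏ j, (1 + x) ^ #({(z j).1, (z j).2} ∩ Q) := (prod_pow_eq_pow_sum _ _ _).symm
    _ ≤ ∏ j, (1 + x) ^ ((if (z j).1 ∈ Q then 1 else 0) + if (z j).2 ∈ Q then 1 else 0) :=
        prod_le_prod (fun _ _ => by positivity) fun j _ =>
          pow_le_pow_right₀ hx1 (card_pair_inter_le _ _ Q)
    _ = _ := prod_congr rfl fun j _ => by
        rw [pairWeight, pow_add]
        split_ifs <;> simp

lemma pow_mul_card_traces_samplePoints_le (h𝓑 : ∀ B ∈ 𝓑, B ⊆ Q) (hd : 𝓑.vcDim ≤ d) {x : ℝ}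
    (hx : 0 ≤ x) (hx1 : x ≤ 1) (z : Fin M → X × X) :
    x ^ d * #(traces 𝓑 (samplePoints z)) ≤
      sampleProd (pairWeight fun a => 1 + if a ∈ Q then x else 0) z := by
  refine (pow_mul_card_le_of_vcDim_le (Z := samplePoints z ∩ Q) (fun T hT => ?_)
    ((vcDim_traces_le 𝓑 _).trans hd) hx hx1).trans (one_add_pow_card_samplePoints_inter_le hx Q z)
  obtain ⟨B, hB, rfl⟩ := mem_image.1 hT
  exact subset_inter inter_subset_right (inter_subset_left.trans (h𝓑 B hB))

/-- The double sampling inequality of Vapnik and Chervonenkis, for samples from `U` and ranges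
inside the smaller set `Q`. -/
lemma pow_mul_sum_sampleProd_mul_pow_le (hw : ∀ a, 0 ≤ w a) (hQ : Q ⊆ U) (h𝓑 : ∀ B ∈ 𝓑, B ⊆ Q)
    (hd : 𝓑.vcDim ≤ d) {x p : ℝ} (hx : 0 ≤ x) (hx1 : x ≤ 1) (hp : 0 ≤ p) {F : Finset (Fin M → X)}
    (hFU : F ⊆ samples U M) (hF : ∀ f ∈ F, ∃ B ∈ 𝓑, p ≤ ∑ a ∈ B, w a ∧ ∀ j, f j ∉ B) :
    x ^ d * ((∑ f ∈ F, sampleProd w f) * (∑ a ∈ U, w a + p) ^ M) ≤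
      ((∑ a ∈ U, w a + x * ∑ a ∈ Q, w a) ^ 2) ^ M := by
  set v : X → ℝ := fun a => 1 + if a ∈ Q then x else 0
  calc x ^ d * ((∑ f ∈ F, sampleProd w f) * (∑ a ∈ U, w a + p) ^ M)
      ≤ x ^ d * ∑ z ∈ samples (U ×ˢ U) M,
          sampleProd (pairWeight w) z * #(traces 𝓑 (samplePoints z)) := by
        gcongr
        exact (sum_sampleProd_mul_pow_le_sum_traceCharge hw (fun B hB => (h𝓑 B hB).trans hQ) hp
          hFU hF).trans (sum_traceCharge_le_sum_card_traces hw U 𝓑)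
    _ = ∑ z ∈ samples (U ×ˢ U) M,
          sampleProd (pairWeight w) z * (x ^ d * #(traces 𝓑 (samplePoints z))) := by
        simp only [mul_sum, mul_left_comm]
    _ ≤ ∑ z ∈ samples (U ×ˢ U) M, sampleProd (pairWeight w) z * sampleProd (pairWeight v) z :=
        sum_le_sum fun z _ => mul_le_mul_of_nonneg_left
          (pow_mul_card_traces_samplePoints_le h𝓑 hd hx hx1 z)
          (sampleProd_nonneg (pairWeight_nonneg hw) z)
    _ = (∑ ab ∈ U ×ˢ U, (w ab.1 * v ab.1) * (w ab.2 * v ab.2)) ^ M := by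
        simp only [sampleProd_mul_sampleProd, sum_sampleProd, pairWeight, mul_mul_mul_comm]
    _ = ((∑ a ∈ U, w a + x * ∑ a ∈ Q, w a) ^ 2) ^ M := by
        rw [sum_product, ← sum_mul_one_add_ite w hQ, sq, sum_mul_sum]

end DoubleSampling

section OneScale

variable {X : Type*} [DecidableEq X] {w : X → ℝ} {𝓡 𝓠 : Finset (Finset X)} {U Q : Finset X}
  {d M : ℕ}

/-- The sample `f` misses the trace on `Q` of a range that occupies at least a quarter of the weight
of `Q`. -/
def MissesHeavy (w : X → ℝ) (𝓡 : Finset (Finset X)) (Q : Finset X) (f : Fin M → X) : Prop :=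
  ∃ R ∈ 𝓡, (∑ a ∈ Q, w a) / 4 ≤ ∑ a ∈ R ∩ Q, w a ∧ ∀ j, f j ∉ R ∩ Q

open Classical in
/-- The members of `𝓠` in which the sample `f` misses a heavy range, so that extra points are
needed there. -/
noncomputable def missed (w : X → ℝ) (𝓡 𝓠 : Finset (Finset X)) (f : Fin M → X) :
    Finset (Finset X) :=
  {Q ∈ 𝓠 | MissesHeavy w 𝓡 Q f}

lemma mem_missed {f : Fin M → X} : Q ∈ missed w 𝓡 𝓠 f ↔ Q ∈ 𝓠 ∧ MissesHeavy w 𝓡 Q f := by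
  classical exact mem_filter

/-- Already for `x = 1 / 32` the gain `u + q / 4` of the ghost sample outweighs the growth
`(u + x * q) ^ 2` of the number of traces. -/
lemma add_div_sq_le_exp_mul {u q r : ℝ} (hq : 0 ≤ q) (hqu : q ≤ u) (hr : r * u ≤ q) :
    (u + 1 / 32 * q) ^ 2 ≤ Real.exp (-(r / 8)) * u * (u + q / 4) := by
  have hu : 0 ≤ u := hq.trans hqu
  have hexp : u - q / 8 ≤ Real.exp (-(r / 8)) * u := by
    calc u - q / 8 ≤ (-(r / 8) + 1) * u := by linarith
      _ ≤ _ := by gcongr; exact Real.add_one_le_exp _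
  calc (u + 1 / 32 * q) ^ 2 ≤ (u - q / 8) * (u + q / 4) := by nlinarith
    _ ≤ _ := by gcongr

lemma thirty_two_le_exp_four : (32 : ℝ) ≤ Real.exp 4 := by
  calc (32 : ℝ) ≤ 2.7 ^ 4 := by norm_num
    _ ≤ Real.exp 1 ^ 4 := by gcongr; linarith [Real.exp_one_gt_d9]
    _ = Real.exp 4 := by rw [← Real.exp_nat_mul]; norm_num

open Classical in
lemma sum_sampleProd_missesHeavy_le (hw : ∀ a, 0 ≤ w a) (hU : 0 < ∑ a ∈ U, w a)
    (hd : 𝓡.vcDim ≤ d) (hQ : Q ⊆ U) {r : ℝ} (hr : r * ∑ a ∈ U, w a ≤ ∑ a ∈ Q, w a) (M : ℕ) :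
    ∑ f ∈ samples U M with MissesHeavy w 𝓡 Q f, sampleProd w f ≤
      Real.exp (4 * d - M * r / 8) * (∑ a ∈ U, w a) ^ M := by
  have hq : 0 ≤ ∑ a ∈ Q, w a := sum_nonneg fun a _ => hw a
  have hqu : ∑ a ∈ Q, w a ≤ ∑ a ∈ U, w a := sum_le_sum_of_subset_of_nonneg hQ fun a _ _ => hw a
  have hdouble := pow_mul_sum_sampleProd_mul_pow_le (𝓑 := traces 𝓡 Q) (x := 1 / 32)
    (p := (∑ a ∈ Q, w a) / 4) (F := {f ∈ samples U M | MissesHeavy w 𝓡 Q f}) hw hQ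
    (fun B hB => by
      obtain ⟨R, -, rfl⟩ := mem_image.1 hB
      exact inter_subset_right)
    ((vcDim_traces_le 𝓡 Q).trans hd) (by norm_num) (by norm_num) (by positivity)
    (filter_subset _ _) fun f hf => by
      obtain ⟨R, hR, hRQ⟩ := (mem_filter.1 hf).2
      exact ⟨R ∩ Q, mem_image_of_mem _ hR, hRQ⟩
  set u := ∑ a ∈ U, w a
  set q := ∑ a ∈ Q, w a
  set m := ∑ f ∈ samples U M with MissesHeavy w 𝓡 Q f, sampleProd w f
  have hcancel :
      m * (u + q / 4) ^ M ≤ 32 ^ d * (Real.exp (-(r / 8)) * u) ^ M * (u + q / 4) ^ M := by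
    calc m * (u + q / 4) ^ M = 32 ^ d * ((1 / 32) ^ d * (m * (u + q / 4) ^ M)) := by
          rw [← mul_assoc, ← mul_pow]
          norm_num
      _ ≤ 32 ^ d * (Real.exp (-(r / 8)) * u * (u + q / 4)) ^ M := by
          gcongr
          exact hdouble.trans (by gcongr; exact add_div_sq_le_exp_mul hq hqu hr)
      _ = _ := by rw [mul_pow, mul_assoc]
  calc m ≤ 32 ^ d * (Real.exp (-(r / 8)) * u) ^ M := le_of_mul_le_mul_right hcancel (by positivity)
    _ ≤ Real.exp 4 ^ d * (Real.exp (-(r / 8)) * u) ^ M := by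
        gcongr
        exact thirty_two_le_exp_four
    _ = Real.exp (4 * d - M * r / 8) * u ^ M := by
        rw [mul_pow, ← mul_assoc, ← Real.exp_nat_mul, ← Real.exp_nat_mul, ← Real.exp_add]
        ring_nf

lemma exists_ne_zero_le_of_sum_mul_le {Ω : Type*} {s : Finset Ω} {W N : Ω → ℝ} {b : ℝ}
    (hW : ∀ f ∈ s, 0 ≤ W f) (hs : 0 < ∑ f ∈ s, W f)
    (hN : ∑ f ∈ s, W f * N f ≤ ∑ f ∈ s, W f * b) : ∃ f ∈ s, W f ≠ 0 ∧ N f ≤ b := by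
  by_contra! h
  obtain ⟨f₀, hf₀, hne⟩ := exists_ne_zero_of_sum_ne_zero hs.ne'
  refine hN.not_gt (sum_lt_sum (fun f hf => ?_) ⟨f₀, hf₀, ?_⟩)
  · rcases eq_or_ne (W f) 0 with h0 | h0
    · rw [h0, zero_mul, zero_mul]
    · exact mul_le_mul_of_nonneg_left (h f hf h0).le (hW f hf)
  · exact mul_lt_mul_of_pos_left (h f₀ hf₀ hne) ((hW f₀ hf₀).lt_of_ne' hne)

lemma exists_card_missed_le (hw : ∀ a, 0 ≤ w a) (hU : 0 < ∑ a ∈ U, w a) (hd : 𝓡.vcDim ≤ d) {r : ℝ}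
    (h𝓠 : ∀ Q ∈ 𝓠, Q ⊆ U ∧ r * ∑ a ∈ U, w a ≤ ∑ a ∈ Q, w a) (M : ℕ) :
    ∃ f : Fin M → X, (∀ j, w (f j) ≠ 0) ∧
      (#(missed w 𝓡 𝓠 f) : ℝ) ≤ #𝓠 * Real.exp (4 * d - M * r / 8) := by
  classical
  have hmean : ∑ f ∈ samples U M, sampleProd w f * #(missed w 𝓡 𝓠 f) ≤
      ∑ f ∈ samples U M, sampleProd w f * (#𝓠 * Real.exp (4 * d - M * r / 8)) := by
    calc ∑ f ∈ samples U M, sampleProd w f * #(missed w 𝓡 𝓠 f)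
        = ∑ f ∈ samples U M, ∑ Q ∈ 𝓠, if MissesHeavy w 𝓡 Q f then sampleProd w f else 0 := by
          refine sum_congr rfl fun f _ => ?_
          rw [← sum_filter, sum_const, nsmul_eq_mul, mul_comm]
          congr!
      _ = ∑ Q ∈ 𝓠, ∑ f ∈ samples U M with MissesHeavy w 𝓡 Q f, sampleProd w f := by
          rw [sum_comm]
          exact sum_congr rfl fun Q _ => (sum_filter _ _).symm
      _ ≤ ∑ _Q ∈ 𝓠, Real.exp (4 * d - M * r / 8) * (∑ a ∈ U, w a) ^ M :=
          sum_le_sum fun Q hQ =>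
            sum_sampleProd_missesHeavy_le hw hU hd (h𝓠 Q hQ).1 (h𝓠 Q hQ).2 M
      _ = _ := by
          rw [← sum_mul, ← sum_mul, sum_sampleProd, sum_const, nsmul_eq_mul, mul_comm]
  obtain ⟨f, -, hf, hfm⟩ := exists_ne_zero_le_of_sum_mul_le
    (fun f _ => sampleProd_nonneg hw f) (by rw [sum_sampleProd]; positivity) hmean
  exact ⟨f, fun j => prod_ne_zero_iff.1 hf j (mem_univ j), hfm⟩

lemma inter_image_nonempty_of_not_missesHeavy {f : Fin M → X} (hf : ¬MissesHeavy w 𝓡 Q f)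
    {R : Finset X} (hR : R ∈ 𝓡) (hRQ : (∑ a ∈ Q, w a) / 4 ≤ ∑ a ∈ R ∩ Q, w a) :
    (R ∩ univ.image f).Nonempty := by
  have hhit : ∃ j, f j ∈ R ∩ Q := by
    by_contra! h
    exact hf ⟨R, hR, hRQ, h⟩
  obtain ⟨j, hj⟩ := hhit
  exact ⟨f j, mem_inter.2 ⟨(mem_inter.1 hj).1, mem_image_of_mem f (mem_univ j)⟩⟩

lemma card_image_univ_fin_le (f : Fin M → X) : #(univ.image f) ≤ M :=
  card_image_le.trans_eq (card_fin M)

lemma exists_quarter_net (hw : ∀ a, 0 ≤ w a) (hQ : 0 < ∑ a ∈ Q, w a) (hd : 𝓡.vcDim ≤ d) :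
    ∃ S : Finset X, (∀ a ∈ S, w a ≠ 0) ∧ #S ≤ 32 * d + 1 ∧
      ∀ R ∈ 𝓡, (∑ a ∈ Q, w a) / 4 ≤ ∑ a ∈ R ∩ Q, w a → (R ∩ S).Nonempty := by
  obtain ⟨f, hf, hcard⟩ := exists_card_missed_le (𝓠 := {Q}) (r := 1) hw hQ hd
    (fun Q' hQ' => by rw [mem_singleton.1 hQ', one_mul]; exact ⟨Subset.rfl, le_rfl⟩) (32 * d + 1)
  have hlt : (#(missed w 𝓡 {Q} f) : ℝ) < 1 := by
    refine hcard.trans_lt ?_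
    rw [card_singleton, Nat.cast_one, one_mul, Real.exp_lt_one_iff]
    push_cast
    linarith
  have hempty : missed w 𝓡 {Q} f = ∅ := by
    rwa [Nat.cast_lt_one, card_eq_zero] at hlt
  have hgood : ¬MissesHeavy w 𝓡 Q f := fun h =>
    eq_empty_iff_forall_notMem.1 hempty Q (mem_missed.2 ⟨mem_singleton_self Q, h⟩)
  refine ⟨univ.image f, fun a ha => ?_, card_image_univ_fin_le f,
    fun R hR hRQ => inter_image_nonempty_of_not_missesHeavy hgood hR hRQ⟩
  obtain ⟨j, -, rfl⟩ := mem_image.1 ha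
  exact hf j

lemma exists_transversal_of_sample (hw : ∀ a, 0 ≤ w a) (hd : 𝓡.vcDim ≤ d)
    (h𝓠 : ∀ Q ∈ 𝓠, 0 < ∑ a ∈ Q, w a)
    (hcov : ∀ R ∈ 𝓡, ∃ Q ∈ 𝓠, (∑ a ∈ Q, w a) / 4 ≤ ∑ a ∈ R ∩ Q, w a) {f : Fin M → X}
    (hf : ∀ j, w (f j) ≠ 0) :
    ∃ S : Finset X, (∀ a ∈ S, w a ≠ 0) ∧ (∀ R ∈ 𝓡, (R ∩ S).Nonempty) ∧
      #S ≤ M + #(missed w 𝓡 𝓠 f) * (32 * d + 1) := by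
  choose! N hN0 hNcard hN using fun Q (hQ : Q ∈ 𝓠) => exists_quarter_net hw (h𝓠 Q hQ) hd
  refine ⟨univ.image f ∪ (missed w 𝓡 𝓠 f).biUnion N, fun a ha => ?_, fun R hR => ?_, ?_⟩
  · rcases mem_union.1 ha with ha | ha
    · obtain ⟨j, -, rfl⟩ := mem_image.1 ha
      exact hf j
    · obtain ⟨Q, hQ, ha⟩ := mem_biUnion.1 ha
      exact hN0 Q (mem_missed.1 hQ).1 a ha
  · obtain ⟨Q, hQ, hRQ⟩ := hcov R hR
    by_cases hQf : MissesHeavy w 𝓡 Q f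
    · exact (hN Q hQ R hR hRQ).mono (inter_subset_inter_left
        ((subset_biUnion_of_mem N (mem_missed.2 ⟨hQ, hQf⟩)).trans subset_union_right))
    · exact (inter_image_nonempty_of_not_missesHeavy hQf hR hRQ).mono
        (inter_subset_inter_left subset_union_left)
  · exact (card_union_le _ _).trans (add_le_add (card_image_univ_fin_le f)
      (card_biUnion_le_card_mul _ _ _ fun Q hQ => hNcard Q (mem_missed.1 hQ).1))

lemma exp_neg_mul_le (d : ℕ) : Real.exp (-d) * (32 * d + 1) ≤ 32 := by
  rw [Real.exp_neg, inv_mul_le_iff₀ (Real.exp_pos _)]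
  linarith [Real.add_one_le_exp (d : ℝ)]

lemma exists_card_missed_le_mul_exp (hw : ∀ a, 0 ≤ w a) (hU : 0 < ∑ a ∈ U, w a) (hd : 𝓡.vcDim ≤ d)
    {s t D : ℝ} (ht : 0 < t) (hD : 0 < D) (h𝓠 : ∀ Q ∈ 𝓠, Q ⊆ U ∧ s ≤ ∑ a ∈ Q, w a)
    (hcard : (#𝓠 : ℝ) ≤ D) (hUs : ∑ a ∈ U, w a ≤ 2 * s * t)
    (hM : 16 * (t * (Real.log (D / t) + 5 * d)) ≤ M) :
    ∃ f : Fin M → X, (∀ j, w (f j) ≠ 0) ∧ (#(missed w 𝓡 𝓠 f) : ℝ) ≤ t * Real.exp (-d) := by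
  obtain ⟨f, hf, hmiss⟩ := exists_card_missed_le (𝓠 := 𝓠) (r := 1 / (2 * t)) hw hU hd
    (fun Q hQ => ⟨(h𝓠 Q hQ).1, by
      rw [one_div, inv_mul_le_iff₀ (by positivity)]
      nlinarith [(h𝓠 Q hQ).2]⟩) M
  refine ⟨f, hf, hmiss.trans ?_⟩
  have hexp : 4 * (d : ℝ) - M * (1 / (2 * t)) / 8 ≤ -Real.log (D / t) + -d := by
    have : Real.log (D / t) + 5 * d ≤ M * (1 / (2 * t)) / 8 := by
      rw [mul_one_div, div_div, le_div_iff₀ (by positivity)]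
      linarith
    linarith
  calc #𝓠 * Real.exp (4 * d - M * (1 / (2 * t)) / 8)
      ≤ D * Real.exp (-Real.log (D / t) + -d) := by gcongr
    _ = t * Real.exp (-d) := by
        rw [Real.exp_add, Real.exp_neg, Real.exp_log (by positivity)]
        field_simp

/-- A sample of about `t * (log (D / t) + d)` points leaves only `t * exp (-d)` members of `𝓠` to be
repaired, with `O(d + 1)` points each. -/
lemma exists_transversal (hw : ∀ a, 0 ≤ w a) (hd : 𝓡.vcDim ≤ d) {s t D : ℝ} (hs : 0 < s)
    (htD : t ≤ D) (h𝓠 : ∀ Q ∈ 𝓠, s ≤ ∑ a ∈ Q, w a) (hcard : (#𝓠 : ℝ) ≤ D)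
    (hU : ∑ a ∈ 𝓠.biUnion id, w a ≤ 2 * s * t)
    (hcov : ∀ R ∈ 𝓡, ∃ Q ∈ 𝓠, (∑ a ∈ Q, w a) / 4 ≤ ∑ a ∈ R ∩ Q, w a) :
    ∃ S : Finset X, (∀ a ∈ S, w a ≠ 0) ∧ (∀ R ∈ 𝓡, (R ∩ S).Nonempty) ∧
      (#S : ℝ) ≤ 80 * (t * (Real.log (D / t) + d + 1)) := by
  have ht0 : 0 ≤ t := by
    have := (sum_nonneg fun a _ => hw a).trans hU
    exact (mul_nonneg_iff_of_pos_left (by positivity)).1 this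
  have hlog : 0 ≤ t * Real.log (D / t) := by
    rcases ht0.eq_or_lt with rfl | ht
    · rw [zero_mul]
    · exact mul_nonneg ht0 (Real.log_nonneg ((one_le_div ht).2 htD))
  rcases 𝓠.eq_empty_or_nonempty with rfl | ⟨Q₀, hQ₀⟩
  · refine ⟨∅, by simp, fun R hR => ?_, ?_⟩
    · obtain ⟨Q, hQ, -⟩ := hcov R hR
      exact absurd hQ (notMem_empty Q)
    · rw [card_empty, Nat.cast_zero]
      nlinarith [mul_nonneg ht0 d.cast_nonneg]
  have hsub : ∀ Q ∈ 𝓠, Q ⊆ 𝓠.biUnion id := fun Q hQ => subset_biUnion_of_mem id hQ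
  have hsU : s ≤ ∑ a ∈ 𝓠.biUnion id, w a :=
    (h𝓠 Q₀ hQ₀).trans (sum_le_sum_of_subset_of_nonneg (hsub Q₀ hQ₀) fun a _ _ => hw a)
  have ht : 1 ≤ 2 * t := le_of_mul_le_mul_left (by linarith) hs
  obtain ⟨f, hf, hmiss⟩ := exists_card_missed_le_mul_exp hw (hs.trans_le hsU) hd (by linarith)
    (by linarith) (fun Q hQ => ⟨hsub Q hQ, h𝓠 Q hQ⟩) hcard hU (Nat.le_ceil _)
  obtain ⟨S, hS0, hS, hScard⟩ :=
    exists_transversal_of_sample hw hd (fun Q hQ => hs.trans_le (h𝓠 Q hQ)) hcov hf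
  refine ⟨S, hS0, hS, ?_⟩
  have hrepair : (#(missed w 𝓡 𝓠 f) : ℝ) * (32 * d + 1) ≤ t * 32 := by
    calc #(missed w 𝓡 𝓠 f) * (32 * (d : ℝ) + 1) ≤ t * Real.exp (-d) * (32 * d + 1) := by gcongr
      _ = t * (Real.exp (-d) * (32 * d + 1)) := mul_assoc _ _ _
      _ ≤ t * 32 := by gcongr; exact exp_neg_mul_le d
  have hceil := Nat.ceil_lt_add_one (a := 16 * (t * (Real.log (D / t) + 5 * d)))
    (by rw [mul_add]; positivity)
  calc (#S : ℝ) ≤ ⌈16 * (t * (Real.log (D / t) + 5 * d))⌉₊ +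
        #(missed w 𝓡 𝓠 f) * (32 * d + 1) := by exact_mod_cast hScard
    _ ≤ 80 * (t * (Real.log (D / t) + d + 1)) := by linarith

end OneScale

section Packing

variable {X : Type*} [MeasurableSpace X] {P : Measure X} {𝓡 𝓠 : Finset (Finset X)} {s t ε : ℝ}

lemma mem_rangesLE {R : Finset X} : R ∈ rangesLE P 𝓡 t ↔ R ∈ 𝓡 ∧ P.real R ≤ t := by
  classical exact mem_filter

lemma rangesLE_subset (P : Measure X) (𝓡 : Finset (Finset X)) (t : ℝ) : rangesLE P 𝓡 t ⊆ 𝓡 :=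
  fun _ hR => (mem_rangesLE.1 hR).1

lemma measureReal_biUnion_le_card_mul (h𝓠 : 𝓠 ⊆ rangesLE P 𝓡 s) :
    P.real (⋃ Q ∈ 𝓠, (Q : Set X)) ≤ #𝓠 * s :=
  calc P.real (⋃ Q ∈ 𝓠, (Q : Set X)) ≤ ∑ Q ∈ 𝓠, P.real Q := measureReal_biUnion_finset_le _ _
    _ ≤ ∑ _Q ∈ 𝓠, s := sum_le_sum fun Q hQ => (mem_rangesLE.1 (h𝓠 hQ)).2
    _ = #𝓠 * s := by rw [sum_const, nsmul_eq_mul]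

variable [DecidableEq X]

lemma card_le_packingNumber (h𝓠 : 𝓠 ⊆ 𝓡) (hpack : IsPacking P t 𝓠) :
    #𝓠 ≤ packingNumber P 𝓡 t := by
  classical exact le_sup (f := card) (mem_filter.2 ⟨mem_powerset.2 h𝓠, hpack⟩)

lemma packingNumber_le {b : ℕ} (h : ∀ 𝓠 ⊆ 𝓡, IsPacking P t 𝓠 → #𝓠 ≤ b) :
    packingNumber P 𝓡 t ≤ b := by
  classical
  refine Finset.sup_le fun 𝓠 h𝓠 => ?_
  obtain ⟨hsub, hpack⟩ := mem_filter.1 h𝓠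
  exact h 𝓠 (mem_powerset.1 hsub) hpack

lemma packingNumber_le_doublingConstant (P : Measure X) (𝓡 : Finset (Finset X)) (hs : ε ≤ s) :
    packingNumber P (rangesLE P 𝓡 (2 * s)) s ≤ doublingConstant P 𝓡 ε := by
  refine le_csSup ⟨#𝓡, ?_⟩ ⟨s, hs, rfl⟩
  rintro _ ⟨r, -, rfl⟩
  exact packingNumber_le fun 𝓠 h𝓠 _ => card_le_card (h𝓠.trans (rangesLE_subset P 𝓡 _))

lemma doublingConstant_le {b : ℕ}
    (h : ∀ s, ε ≤ s → ∀ 𝓠 ⊆ rangesLE P 𝓡 (2 * s), IsPacking P s 𝓠 → #𝓠 ≤ b) :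
    doublingConstant P 𝓡 ε ≤ b := by
  refine csSup_le ⟨_, ε, Set.self_mem_Ici, rfl⟩ ?_
  rintro _ ⟨s, hs, rfl⟩
  exact packingNumber_le (h s hs)

lemma one_le_doublingConstant (P : Measure X) (h𝓡 : 𝓡.Nonempty) (ε : ℝ) :
    1 ≤ doublingConstant P 𝓡 ε := by
  obtain ⟨R, hR⟩ := h𝓡
  set s := max ε (P.real R)
  have hRs : {R} ⊆ rangesLE P 𝓡 (2 * s) := by
    rw [singleton_subset_iff, mem_rangesLE]
    have hle : P.real R ≤ s := le_max_right _ _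
    exact ⟨hR, by linarith [measureReal_nonneg (μ := P) (s := R)]⟩
  have hpack : IsPacking P s {R} := fun A hA B hB hAB =>
    absurd ((mem_singleton.1 hA).trans (mem_singleton.1 hB).symm) hAB
  calc 1 = #{R} := (card_singleton R).symm
    _ ≤ packingNumber P (rangesLE P 𝓡 (2 * s)) s := card_le_packingNumber hRs hpack
    _ ≤ doublingConstant P 𝓡 ε := packingNumber_le_doublingConstant P 𝓡 (le_max_left _ _)

lemma exists_isPacking_forall_symmDiff_lt (P : Measure X) (𝓑 : Finset (Finset X)) (s : ℝ) :
    ∃ 𝓠 ⊆ 𝓑, IsPacking P s 𝓠 ∧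
      ∀ R ∈ 𝓑, R ∉ 𝓠 → ∃ Q ∈ 𝓠, P.real (symmDiff R Q : Finset X) < s := by
  classical
  obtain ⟨𝓠, h𝓠, hmax⟩ := exists_max_image {𝓠 ∈ 𝓑.powerset | IsPacking P s 𝓠} card
    ⟨∅, by simp [IsPacking]⟩
  obtain ⟨hsub, hpack⟩ := mem_filter.1 h𝓠
  rw [mem_powerset] at hsub
  refine ⟨𝓠, hsub, hpack, fun R hR hRQ => ?_⟩
  by_contra! h
  have hins : IsPacking P s (insert R 𝓠) := by
    intro A hA B hB hAB
    rcases mem_insert.1 hA with rfl | hA' <;> rcases mem_insert.1 hB with rfl | hB'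
    · exact absurd rfl hAB
    · exact h B hB'
    · rw [symmDiff_comm]; exact h A hA'
    · exact hpack A hA' B hB' hAB
  have hcard := hmax (insert R 𝓠)
    (mem_filter.2 ⟨mem_powerset.2 (insert_subset hR hsub), hins⟩)
  rw [card_insert_of_notMem hRQ] at hcard
  omega

variable [MeasurableSingletonClass X] [IsFiniteMeasure P]

lemma measureReal_symmDiff_add_two_mul_inter (A B : Finset X) :
    P.real (symmDiff A B : Finset X) + 2 * P.real (A ∩ B : Finset X) = P.real A + P.real B := by
  have hA := measureReal_inter_add_sdiff (μ := P) (s := A) B.measurableSet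
  have hB := measureReal_inter_add_sdiff (μ := P) (s := B) A.measurableSet
  rw [Set.inter_comm] at hB
  rw [coe_symmDiff, coe_inter, measureReal_symmDiff_eq A.measurableSet B.measurableSet]
  linarith

/-- A maximal packing at scale `s` exhausts the ranges of measure in `[s, 2 * s]` up to a quarter:
two of them at distance less than `s` have intersection of measure more than `s / 2`. -/
lemma exists_net_of_scale {d : ℕ} (hd : 𝓡.vcDim ≤ d) {D : ℝ} (hs : 0 < s) (htD : t ≤ D)
    (hpack : (packingNumber P (rangesLE P 𝓡 (2 * s)) s : ℝ) ≤ D)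
    (hU : ∀ 𝓠 ⊆ rangesLE P 𝓡 (2 * s), (#𝓠 : ℝ) ≤ D →
      P.real (⋃ Q ∈ 𝓠, (Q : Set X)) ≤ 2 * s * t) :
    ∃ S : Finset X, (∀ a ∈ S, P {a} ≠ 0) ∧
      (∀ R ∈ 𝓡, s ≤ P.real R → P.real R ≤ 2 * s → (R ∩ S).Nonempty) ∧
      (#S : ℝ) ≤ 80 * (t * (Real.log (D / t) + d + 1)) := by
  classical
  set 𝓑 : Finset (Finset X) := {R ∈ rangesLE P 𝓡 (2 * s) | s ≤ P.real (R : Set X)}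
  have h𝓑 : 𝓑 ⊆ rangesLE P 𝓡 (2 * s) := filter_subset _ _
  have hge : ∀ R ∈ 𝓑, s ≤ P.real R := fun R hR => (mem_filter.1 hR).2
  have hle : ∀ R ∈ 𝓑, P.real R ≤ 2 * s := fun R hR => (mem_rangesLE.1 (h𝓑 hR)).2
  obtain ⟨𝓠, h𝓠, h𝓠pack, hcov⟩ := exists_isPacking_forall_symmDiff_lt P 𝓑 s
  have hcard : (#𝓠 : ℝ) ≤ D :=
    (Nat.cast_le.2 (card_le_packingNumber (h𝓠.trans h𝓑) h𝓠pack)).trans hpack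
  have hquarter : ∀ R ∈ 𝓑, ∃ Q ∈ 𝓠, P.real Q / 4 ≤ P.real (R ∩ Q : Finset X) := fun R hR => by
    by_cases hRQ : R ∈ 𝓠
    · refine ⟨R, hRQ, ?_⟩
      rw [inter_self]
      linarith [hge R hR]
    · obtain ⟨Q, hQ, hlt⟩ := hcov R hR hRQ
      refine ⟨Q, hQ, ?_⟩
      linarith [measureReal_symmDiff_add_two_mul_inter (P := P) R Q, hge R hR, hge Q (h𝓠 hQ),
        hle Q (h𝓠 hQ)]
  obtain ⟨S, hS0, hS, hScard⟩ := exists_transversal (w := fun a => P.real {a}) (𝓡 := 𝓑) (𝓠 := 𝓠)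
    (fun a => measureReal_nonneg)
    ((vcDim_mono (h𝓑.trans (rangesLE_subset P 𝓡 _))).trans hd) hs htD
    (fun Q hQ => by rw [sum_measureReal_singleton]; exact hge Q (h𝓠 hQ)) hcard
    (by rw [sum_measureReal_singleton, coe_biUnion]; exact hU 𝓠 (h𝓠.trans h𝓑) hcard)
    (by simpa only [sum_measureReal_singleton] using hquarter)
  exact ⟨S, fun a ha h0 => hS0 a ha (by rw [measureReal_def, h0, ENNReal.toReal_zero]),
    fun R hR hsR hRs => hS R (mem_filter.2 ⟨mem_rangesLE.2 ⟨hR, hRs⟩, hsR⟩), hScard⟩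

end Packing

section Capacity

variable {X : Type*} [MeasurableSpace X] (P : Measure X) [IsFiniteMeasure P]
  (𝓡 : Finset (Finset X))

lemma bddAbove_capacity {ε : ℝ} (hε : 0 < ε) : BddAbove
    ((fun s : ℝ => P.real (⋃ R ∈ rangesLE P 𝓡 s, (R : Set X)) / s) '' Set.Ici ε) := by
  refine ⟨P.real Set.univ / ε, ?_⟩
  rintro _ ⟨s, hs, rfl⟩
  exact div_le_div₀ measureReal_nonneg (measureReal_mono (Set.subset_univ _)) hε hs

lemma measureReal_biUnion_rangesLE_le {s : ℝ} (hs : 0 < s) :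
    P.real (⋃ R ∈ rangesLE P 𝓡 s, (R : Set X)) ≤ s * capacity P 𝓡 s := by
  rw [← div_le_iff₀' hs]
  exact le_csSup (bddAbove_capacity P 𝓡 hs) ⟨s, Set.self_mem_Ici, rfl⟩

lemma antitoneOn_capacity : AntitoneOn (capacity P 𝓡) (Set.Ioi 0) := fun _ hr s _ hrs =>
  csSup_le_csSup (bddAbove_capacity P 𝓡 hr) ⟨_, s, Set.self_mem_Ici, rfl⟩
    (Set.image_mono (Set.Ici_subset_Ici.2 hrs))

lemma antitoneOn_truncCapacity : AntitoneOn (truncCapacity P 𝓡) (Set.Ioi 0) := fun _ hr _ hs hrs =>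
  max_le_max (antitoneOn_capacity P 𝓡 hr hs hrs) le_rfl

end Capacity

section UpperBounds

variable {X : Type*} [DecidableEq X] [MeasurableSpace X] {P : Measure X} [IsProbabilityMeasure P]
  {𝓡 : Finset (Finset X)} {ε : ℝ}

lemma mem_Icc_numScales {k : ℕ} (hε : 0 < ε) (hk : 2 ^ k * ε ≤ 1) :
    k + 1 ∈ Icc 1 (numScales ε) := by
  have hlog : (k : ℝ) ≤ Real.logb 2 (1 / ε) := by
    rw [Real.le_logb_iff_rpow_le one_lt_two (by positivity), Real.rpow_natCast]
    exact (le_div_iff₀ hε).2 hk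
  have hceil : (k : ℤ) ≤ ⌈Real.logb 2 (1 / ε)⌉ := by exact_mod_cast hlog.trans (Int.le_ceil _)
  refine mem_Icc.2 ⟨by omega, ?_⟩
  unfold numScales
  omega

lemma exists_isEpsNet_of_scales (hε : 0 < ε) {T : ℕ → ℝ}
    (h : ∀ i ∈ Icc 1 (numScales ε), ∃ S : Finset X, (∀ a ∈ S, P {a} ≠ 0) ∧
      (∀ R ∈ 𝓡, 2 ^ i * ε / 2 ≤ P.real R → P.real R ≤ 2 ^ i * ε → (R ∩ S).Nonempty) ∧
      (#S : ℝ) ≤ T i) :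
    ∃ S : Finset X, IsEpsNet P 𝓡 ε S ∧ (#S : ℝ) ≤ ∑ i ∈ Icc 1 (numScales ε), T i := by
  choose! S hS0 hS hScard using h
  refine ⟨(Icc 1 (numScales ε)).biUnion S, ⟨fun a ha => ?_, fun R hR hRε => ?_⟩, ?_⟩
  · obtain ⟨i, hi, ha⟩ := mem_biUnion.1 ha
    exact hS0 i hi a ha
  · obtain ⟨k, hkR, hRk⟩ := exists_nat_pow_near ((one_le_div hε).2 hRε) one_lt_two
    rw [le_div_iff₀ hε] at hkR
    rw [div_lt_iff₀ hε] at hRk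
    have hmem := mem_Icc_numScales hε (hkR.trans measureReal_le_one)
    refine (hS (k + 1) hmem R hR ?_ hRk.le).mono
      (inter_subset_inter_left (subset_biUnion_of_mem S hmem))
    rw [pow_succ]
    linarith
  · calc (#((Icc 1 (numScales ε)).biUnion S) : ℝ) ≤ ∑ i ∈ Icc 1 (numScales ε), (#(S i) : ℝ) := by
          exact_mod_cast card_biUnion_le
      _ ≤ _ := sum_le_sum hScard

variable [MeasurableSingletonClass X] {d : ℕ} {D : ℝ}

/-- Both upper bounds are instances of this one, for different bounds `t i` on the measure of a
union of at most `D` ranges at the `i`-th dyadic scale. -/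
lemma exists_isEpsNet_of_measureReal_biUnion_le (hd : 𝓡.vcDim ≤ d) (hε : 0 < ε)
    (hD : (doublingConstant P 𝓡 ε : ℝ) ≤ D) {t : ℕ → ℝ}
    (htD : ∀ i ∈ Icc 1 (numScales ε), t i ≤ D)
    (ht : ∀ i ∈ Icc 1 (numScales ε), ∀ 𝓠 ⊆ rangesLE P 𝓡 (2 ^ i * ε), (#𝓠 : ℝ) ≤ D →
      P.real (⋃ Q ∈ 𝓠, (Q : Set X)) ≤ 2 ^ i * ε * t i) :
    ∃ S : Finset X, IsEpsNet P 𝓡 ε S ∧ (#S : ℝ) ≤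
      ∑ i ∈ Icc 1 (numScales ε), 80 * (t i * (Real.log (D / t i) + d + 1)) := by
  refine exists_isEpsNet_of_scales hε fun i hi => ?_
  have hscale : ε ≤ 2 ^ i * ε / 2 := by
    have hi2 : (2 : ℝ) ≤ 2 ^ i := le_self_pow₀ one_le_two (by grind)
    nlinarith
  have htwo : 2 * (2 ^ i * ε / 2) = 2 ^ i * ε := by ring
  have hnet := exists_net_of_scale (s := 2 ^ i * ε / 2) hd (by positivity) (htD i hi)
    ((Nat.cast_le.2 (packingNumber_le_doublingConstant P 𝓡 hscale)).trans hD)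
    (by rw [htwo]; exact ht i hi)
  rwa [htwo] at hnet

lemma exists_isEpsNet_of_capacity_le (hd : 𝓡.vcDim ≤ d) (hε : 0 < ε)
    (hD : (doublingConstant P 𝓡 ε : ℝ) ≤ D) {τ : ℝ → ℝ} (hτ : AntitoneOn τ (Set.Ioi 0))
    (hcap : ∀ s, 0 < s → capacity P 𝓡 s ≤ τ s) (hτD : 2 * τ (2 * ε) ≤ D) :
    ∃ S : Finset X, IsEpsNet P 𝓡 ε S ∧ (#S : ℝ) ≤ 240 * ∑ i ∈ Icc 1 (numScales ε),
        (Real.log (D / τ (2 ^ i * ε)) + d) * τ (2 ^ i * ε) := by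
  have hunion : ∀ s, 0 < s → ∀ 𝓠 ⊆ rangesLE P 𝓡 s,
      P.real (⋃ Q ∈ 𝓠, (Q : Set X)) ≤ s * τ s := fun s hs 𝓠 h𝓠 =>
    calc P.real (⋃ Q ∈ 𝓠, (Q : Set X)) ≤ P.real (⋃ R ∈ rangesLE P 𝓡 s, (R : Set X)) :=
          measureReal_mono (Set.biUnion_mono h𝓠 fun _ _ => le_rfl) (measure_ne_top P _)
      _ ≤ s * capacity P 𝓡 s := measureReal_biUnion_rangesLE_le P 𝓡 hs
      _ ≤ s * τ s := by gcongr; exact hcap s hs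
  have hτ0 : ∀ s, 0 < s → 0 ≤ τ s := fun s hs =>
    nonneg_of_mul_nonneg_right (measureReal_nonneg.trans (hunion s hs ∅ (empty_subset _))) hs
  have htwo_mul : ∀ i ∈ Icc 1 (numScales ε), 2 * τ (2 ^ i * ε) ≤ D := fun i hi => by
    have hi2 : (2 : ℝ) ≤ 2 ^ i := le_self_pow₀ one_le_two (by grind)
    have hle : τ (2 ^ i * ε) ≤ τ (2 * ε) :=
      hτ (Set.mem_Ioi.2 (by positivity)) (Set.mem_Ioi.2 (by positivity)) (by gcongr)
    linarith
  obtain ⟨S, hS, hScard⟩ := exists_isEpsNet_of_measureReal_biUnion_le (t := fun i => τ (2 ^ i * ε))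
    hd hε hD (fun i hi => by linarith [htwo_mul i hi, hτ0 (2 ^ i * ε) (by positivity)])
    fun i _ 𝓠 h𝓠 _ => hunion _ (by positivity) 𝓠 h𝓠
  refine ⟨S, hS, hScard.trans ?_⟩
  rw [mul_sum]
  refine sum_le_sum fun i hi => ?_
  rcases (hτ0 (2 ^ i * ε) (by positivity)).eq_or_lt with h0 | hpos
  · rw [← h0]
    simp
  · have hlog : Real.log 2 ≤ Real.log (D / τ (2 ^ i * ε)) :=
      Real.log_le_log two_pos ((le_div_iff₀ hpos).2 (htwo_mul i hi))
    have habsorb : Real.log (D / τ (2 ^ i * ε)) + d + 1 ≤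
        3 * (Real.log (D / τ (2 ^ i * ε)) + d) := by
      linarith [Real.log_two_gt_d9, d.cast_nonneg (α := ℝ)]
    linarith [mul_le_mul_of_nonneg_left habsorb hpos.le]

lemma sum_range_succ_div_two_pow (n : ℕ) :
    ∑ j ∈ range n, ((j : ℝ) + 1) / 2 ^ j = 4 - (2 * n + 4) / 2 ^ n := by
  induction n with
  | zero => norm_num
  | succ n ih =>
    rw [sum_range_succ, ih]
    push_cast
    field_simp
    ring

lemma sum_Icc_succ_div_two_pow_le (k z : ℕ) :
    ∑ i ∈ Icc 1 z, (((i - k : ℕ) : ℝ) + 1) / 2 ^ (i - k) ≤ k + 4 := by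
  calc ∑ i ∈ Icc 1 z, (((i - k : ℕ) : ℝ) + 1) / 2 ^ (i - k)
      ≤ ∑ i ∈ range (k + (z + 1)), (((i - k : ℕ) : ℝ) + 1) / 2 ^ (i - k) :=
        sum_le_sum_of_subset_of_nonneg (fun i hi => by grind) fun _ _ _ => by positivity
    _ = ∑ _i ∈ range k, (1 : ℝ) + ∑ j ∈ range (z + 1), ((j : ℝ) + 1) / 2 ^ j := by
        rw [sum_range_add]
        congr 1
        · refine sum_congr rfl fun i hi => ?_
          rw [Nat.sub_eq_zero_of_le (mem_range.1 hi).le]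
          norm_num
        · simp only [Nat.add_sub_cancel_left]
    _ ≤ k + 4 := by
        have htail : (0 : ℝ) ≤ (2 * (z + 1 : ℕ) + 4) / 2 ^ (z + 1) := by positivity
        rw [sum_range_succ_div_two_pow, sum_const, card_range, nsmul_one]
        linarith

/-- The union bound controls the scales up to `1 / (ε * D) ≈ 2 ^ k`, the total mass the ones above,
where the measure of a union grows no more while the scale doubles. -/
lemma exists_isEpsNet_of_lt_two_pow (hd : 𝓡.vcDim ≤ d) (hd1 : 1 ≤ d) (hε : 0 < ε) (hD0 : 0 < D)
    (hD : (doublingConstant P 𝓡 ε : ℝ) ≤ D) {k : ℕ} (hk : 1 / (ε * D) ≤ 2 ^ k) :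
    ∃ S : Finset X, IsEpsNet P 𝓡 ε S ∧ (#S : ℝ) ≤ 160 * (d * D) * (k + 4) := by
  obtain ⟨S, hS, hScard⟩ := exists_isEpsNet_of_measureReal_biUnion_le
    (t := fun i => D / 2 ^ (i - k)) hd hε hD
    (fun i _ => div_le_self hD0.le (one_le_pow₀ one_le_two)) fun i _ 𝓠 h𝓠 hcard => by
      rcases le_total i k with hik | hki
      · rw [Nat.sub_eq_zero_of_le hik, pow_zero, div_one, mul_comm]
        exact (measureReal_biUnion_le_card_mul h𝓠).trans (by gcongr)
      · calc P.real (⋃ Q ∈ 𝓠, (Q : Set X)) ≤ 1 := measureReal_le_one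
          _ ≤ 2 ^ k * (ε * D) := (div_le_iff₀ (by positivity)).1 hk
          _ = 2 ^ i * ε * (D / 2 ^ (i - k)) := by
              rw [← Nat.add_sub_of_le hki, pow_add, Nat.add_sub_cancel_left]
              field_simp
  refine ⟨S, hS, hScard.trans ?_⟩
  have hd1' : (1 : ℝ) ≤ d := by exact_mod_cast hd1
  have hterm : ∀ j : ℕ, 80 * (D / 2 ^ j * (Real.log (D / (D / 2 ^ j)) + d + 1)) ≤
      160 * (d * D) * ((j + 1) / 2 ^ j) := fun j => by
    have hlog : Real.log (D / (D / 2 ^ j)) ≤ j := by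
      rw [div_div_cancel₀ hD0.ne', Real.log_pow]
      exact mul_le_of_le_one_right j.cast_nonneg (Real.log_two_lt_d9.le.trans (by norm_num))
    calc 80 * (D / 2 ^ j * (Real.log (D / (D / 2 ^ j)) + d + 1))
        ≤ 80 * (D / 2 ^ j * (2 * d * (j + 1))) := by
          gcongr
          nlinarith [j.cast_nonneg (α := ℝ)]
      _ = 160 * (d * D) * ((j + 1) / 2 ^ j) := by ring
  calc _ ≤ ∑ i ∈ Icc 1 (numScales ε), 160 * (d * D) * ((((i - k : ℕ) : ℝ) + 1) / 2 ^ (i - k)) :=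
        sum_le_sum fun i _ => hterm (i - k)
    _ ≤ 160 * (d * D) * (k + 4) := by
        rw [← mul_sum]
        gcongr
        exact sum_Icc_succ_div_two_pow_le k _

lemma exists_isEpsNet_of_doublingConstant_le (hd : 𝓡.vcDim ≤ d) (hd1 : 1 ≤ d) (hε : 0 < ε)
    (hD : (doublingConstant P 𝓡 ε : ℝ) ≤ D) (hDε : D ≤ 1 / (2 * ε)) :
    ∃ S : Finset X, IsEpsNet P 𝓡 ε S ∧ (#S : ℝ) ≤ 1440 * (d * D * Real.log (1 / (ε * D))) := by
  have hD0 : 0 ≤ D := (Nat.cast_nonneg _).trans hD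
  have hy (hpos : 0 < D) : 2 ≤ 1 / (ε * D) := by
    rw [le_div_iff₀ (by positivity)] at hDε ⊢
    linarith
  rcases 𝓡.eq_empty_or_nonempty with rfl | hne
  · refine ⟨∅, ⟨by simp, by simp⟩, ?_⟩
    rw [card_empty, Nat.cast_zero]
    rcases hD0.eq_or_lt with rfl | hpos
    · simp
    · have := Real.log_nonneg (one_le_two.trans (hy hpos))
      positivity
  have hpos : 0 < D :=
    zero_lt_one.trans_le (le_trans (by exact_mod_cast one_le_doublingConstant P hne ε) hD)
  obtain ⟨k, hky, hyk⟩ :=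
    exists_nat_pow_near (one_le_two.trans (hy hpos)) (one_lt_two (α := ℝ))
  obtain ⟨S, hS, hScard⟩ := exists_isEpsNet_of_lt_two_pow hd hd1 hε hpos hD hyk.le
  refine ⟨S, hS, hScard.trans ?_⟩
  have hklog : k * Real.log 2 ≤ Real.log (1 / (ε * D)) := by
    rw [← Real.log_pow]
    exact Real.log_le_log (by positivity) hky
  have hlog : Real.log 2 ≤ Real.log (1 / (ε * D)) := Real.log_le_log two_pos (hy hpos)
  have hk : ((k + 1 : ℕ) : ℝ) + 4 ≤ 9 * Real.log (1 / (ε * D)) := by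
    push_cast
    nlinarith [Real.log_two_gt_d9, k.cast_nonneg (α := ℝ)]
  calc 160 * (d * D) * (((k + 1 : ℕ) : ℝ) + 4)
      ≤ 160 * (d * D) * (9 * Real.log (1 / (ε * D))) := by gcongr
    _ = 1440 * (d * D * Real.log (1 / (ε * D))) := by ring

end UpperBounds

section BlockRanges

open ProbabilityTheory

variable {X ι : Type*} [Fintype ι]

lemma measureReal_uniformOn_univ [Fintype X] [MeasurableSpace X]
    [MeasurableSingletonClass X] (A : Finset X) :
    (uniformOn (Set.univ : Set X)).real (A : Set X) = (#A : ℝ) / Fintype.card X := by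
  rw [measureReal_def, uniformOn_univ, Measure.count_apply_finset]
  simp

lemma exists_pairwise_disjoint_card_eq [Fintype X] {g : ι → ℕ}
    (hg : ∑ j, g j ≤ Fintype.card X) :
    ∃ G : ι → Finset X, Pairwise (Function.onFun Disjoint G) ∧ ∀ j, #(G j) = g j := by
  obtain ⟨φ⟩ := Function.Embedding.nonempty_of_card_le (α := Σ j, Fin (g j)) (β := X)
    (by simpa using hg)
  refine ⟨fun j => univ.map ((Function.Embedding.sigmaMk j).trans φ), fun i j hij => ?_, by simp⟩
  refine disjoint_left.2 fun a hi hj => hij ?_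
  obtain ⟨x, -, rfl⟩ := mem_map.1 hi
  obtain ⟨y, -, hy⟩ := mem_map.1 hj
  exact (congrArg Sigma.fst (φ.injective hy)).symm

variable [DecidableEq X]

/-- The ranges of the extremal example: all subsets of size `s j` of the block `G j`, for each `j`.
A net has to leave fewer than `s j` points of `G j`. -/
def blockRanges (G : ι → Finset X) (s : ι → ℕ) : Finset (Finset X) :=
  univ.biUnion fun j => (G j).powersetCard (s j)

variable {G : ι → Finset X} {s : ι → ℕ} {e : ℕ}

lemma mem_blockRanges {R : Finset X} : R ∈ blockRanges G s ↔ ∃ j, R ⊆ G j ∧ #R = s j := by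
  simp [blockRanges]

lemma vcDim_blockRanges_le (hG : Pairwise (Function.onFun Disjoint G))
    (hcard : ∀ j, #(G j) = s j + e) : (blockRanges G s).vcDim ≤ e + 1 := by
  refine Finset.sup_le fun Y hY => ?_
  rw [mem_shatterer] at hY
  rcases Y.eq_empty_or_nonempty with rfl | ⟨a, ha⟩
  · simp
  obtain ⟨R, hR, hYR⟩ := hY.exists_superset
  obtain ⟨i, hRi, -⟩ := mem_blockRanges.1 hR
  obtain ⟨R', hR', hYR'⟩ := hY (singleton_subset_iff.2 ha)
  obtain ⟨j, hRj, hRcard⟩ := mem_blockRanges.1 hR'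
  have haR' : a ∈ R' := (mem_inter.1 (hYR' ▸ mem_singleton_self a)).2
  obtain rfl : i = j := by
    by_contra hij
    exact disjoint_left.1 (hG hij) (hRi (hYR ha)) (hRj haR')
  have hsub : Y.erase a ⊆ G i \ R' := fun b hb => by
    obtain ⟨hba, hbY⟩ := mem_erase.1 hb
    exact mem_sdiff.2 ⟨hRi (hYR hbY), fun hbR =>
      hba (mem_singleton.1 (hYR' ▸ mem_inter.2 ⟨hbY, hbR⟩))⟩
  have hle := card_le_card hsub
  rw [card_sdiff_of_subset hRj, hcard, hRcard, card_erase_of_mem ha] at hle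
  omega

lemma card_mul_le_card_of_forall_inter_nonempty (hG : Pairwise (Function.onFun Disjoint G))
    (hcard : ∀ j, #(G j) = s j + e) {S : Finset X}
    (hS : ∀ R ∈ blockRanges G s, (R ∩ S).Nonempty) : Fintype.card ι * (e + 1) ≤ #S := by
  have hblock : ∀ j, e + 1 ≤ #(G j ∩ S) := fun j => by
    by_contra! h
    have hle : s j ≤ #(G j \ S) := by
      have := card_inter_add_card_sdiff (G j) S
      rw [hcard] at this
      omega
    obtain ⟨R, hR, hRcard⟩ := exists_subset_card_eq hle
    obtain ⟨a, ha⟩ := hS R (mem_blockRanges.2 ⟨j, hR.trans sdiff_subset, hRcard⟩)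
    exact (mem_sdiff.1 (hR (mem_inter.1 ha).1)).2 (mem_inter.1 ha).2
  calc Fintype.card ι * (e + 1) = ∑ _j : ι, (e + 1) := by
        rw [sum_const, card_univ, smul_eq_mul]
    _ ≤ ∑ j, #(G j ∩ S) := sum_le_sum fun j _ => hblock j
    _ = #(univ.biUnion fun j => G j ∩ S) :=
        (card_biUnion fun i _ j _ hij => (hG hij).mono inter_subset_left inter_subset_left).symm
    _ ≤ #S := card_le_card (biUnion_subset.2 fun j _ => inter_subset_right)

lemma card_symmDiff_le_of_subset {A B g : Finset X} {k : ℕ} (hg : #g = k + e) (hA : A ⊆ g)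
    (hAcard : #A = k) (hB : B ⊆ g) (hBcard : #B = k) : #(symmDiff A B) ≤ 2 * e := by
  have hAB := card_le_card (sdiff_subset_sdiff hA (le_refl B))
  have hBA := card_le_card (sdiff_subset_sdiff hB (le_refl A))
  rw [card_sdiff_of_subset hB, hg, hBcard] at hAB
  rw [card_sdiff_of_subset hA, hg, hAcard] at hBA
  have hunion : #(symmDiff A B) ≤ #(A \ B) + #(B \ A) := card_union_le _ _
  omega

variable [MeasurableSpace X] [MeasurableSingletonClass X] {𝓠 : Finset (Finset X)} {r : ℝ} {b : ℕ}

lemma card_filter_lt_half_le_one {P : Measure X} [IsFiniteMeasure P] (hpack : IsPacking P r 𝓠) :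
    #(𝓠.filter fun A : Finset X => P.real (A : Set X) < r / 2) ≤ 1 := by
  refine card_le_one.2 fun A hA B hB => ?_
  obtain ⟨hA, hAr⟩ := mem_filter.1 hA
  obtain ⟨hB, hBr⟩ := mem_filter.1 hB
  by_contra hne
  linarith [hpack A hA B hB hne, measureReal_symmDiff_add_two_mul_inter (P := P) A B,
    measureReal_nonneg (μ := P) (s := ↑(A ∩ B))]

variable [Fintype X] [Nonempty X] {ε : ℝ}

/-- Subsets of the same block are too close to each other for a packing, so that the packing has at
most one member per block. -/
lemma card_filter_half_le_le (hcard : ∀ j, #(G j) = s j + e)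
    (he : ((2 * e : ℕ) : ℝ) < r * Fintype.card X)
    (hs : ∀ q : ℝ, #{j | q ≤ s j ∧ s j ≤ 4 * q} ≤ b)
    (h𝓠 : 𝓠 ⊆ rangesLE (uniformOn Set.univ) (blockRanges G s) (2 * r))
    (hpack : IsPacking (uniformOn Set.univ) r 𝓠) :
    #(𝓠.filter fun A : Finset X => r / 2 ≤ (uniformOn Set.univ).real (A : Set X)) ≤ b := by
  have hN : (0 : ℝ) < Fintype.card X := by exact_mod_cast Fintype.card_pos
  refine le_trans ?_ (hs (r / 2 * Fintype.card X))
  refine card_le_card_of_forall_subsingleton (fun A j => A ⊆ G j ∧ #A = s j) (fun A hA => ?_)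
    fun j _ A hA B hB => ?_
  · obtain ⟨hA, hAr⟩ := mem_filter.1 hA
    obtain ⟨hAblock, hAle⟩ := mem_rangesLE.1 (h𝓠 hA)
    obtain ⟨j, hAj, hAcard⟩ := mem_blockRanges.1 hAblock
    rw [measureReal_uniformOn_univ, hAcard] at hAr hAle
    rw [le_div_iff₀ hN] at hAr
    rw [div_le_iff₀ hN] at hAle
    exact ⟨j, mem_filter.2 ⟨mem_univ j, hAr, by linarith⟩, hAj, hAcard⟩
  · obtain ⟨hA, hAj, hAcard⟩ := hA
    obtain ⟨hB, hBj, hBcard⟩ := hB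
    by_contra hne
    have hdist := hpack A (mem_filter.1 hA).1 B (mem_filter.1 hB).1 hne
    rw [measureReal_uniformOn_univ, le_div_iff₀ hN] at hdist
    have hclose : (#(symmDiff A B) : ℝ) ≤ (2 * e : ℕ) :=
      Nat.cast_le.2 (card_symmDiff_le_of_subset (hcard j) hAj hAcard hBj hBcard)
    linarith

lemma doublingConstant_blockRanges_le (hcard : ∀ j, #(G j) = s j + e)
    (he : ((2 * e : ℕ) : ℝ) < ε * Fintype.card X)
    (hs : ∀ q : ℝ, #{j | q ≤ s j ∧ s j ≤ 4 * q} ≤ b) :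
    doublingConstant (uniformOn Set.univ) (blockRanges G s) ε ≤ b + 1 := by
  have : IsProbabilityMeasure (uniformOn (Set.univ : Set X)) :=
    isProbabilityMeasure_uniformOn Set.finite_univ Set.univ_nonempty
  refine doublingConstant_le fun r hr 𝓠 h𝓠 hpack => ?_
  have hlight := card_filter_lt_half_le_one hpack
  have hheavy := card_filter_half_le_le hcard
    (he.trans_le (mul_le_mul_of_nonneg_right hr (Nat.cast_nonneg _))) hs h𝓠 hpack
  rw [← card_filter_add_card_filter_not (s := 𝓠)
    fun A => (uniformOn (Set.univ : Set X)).real (A : Set X) < r / 2]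
  simp only [not_lt]
  omega

end BlockRanges

section LowerBound

open ProbabilityTheory

/-- Any ratio larger than `4` between successive sizes would do: a packing of ranges of measure at
most `2 * r` has at most one member of measure less than `r / 2`. -/
lemma card_filter_five_pow_mul_le {a : ℕ} (ha : 0 < a) (m b : ℕ) (q : ℝ) :
    #{j : Fin m × Fin b | q ≤ (5 ^ (j.1 : ℕ) * a : ℕ) ∧ (5 ^ (j.1 : ℕ) * a : ℕ) ≤ 4 * q} ≤ b := by
  have hnot_lt : ∀ i j : Fin m, q ≤ (5 ^ (i : ℕ) * a : ℕ) → (5 ^ (j : ℕ) * a : ℕ) ≤ 4 * q →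
      ¬i < j := fun i j hi hj hij => by
    have hfive : 5 * (5 ^ (i : ℕ) * a) ≤ 5 ^ (j : ℕ) * a := by
      rw [← mul_assoc, ← pow_succ']
      exact Nat.mul_le_mul_right a (Nat.pow_le_pow_right (by norm_num) hij)
    have hfive' : (5 : ℝ) * (5 ^ (i : ℕ) * a : ℕ) ≤ (5 ^ (j : ℕ) * a : ℕ) := by
      exact_mod_cast hfive
    have hpos : (0 : ℝ) < (5 ^ (i : ℕ) * a : ℕ) := by positivity
    linarith
  calc _ ≤ #(univ : Finset (Fin b)) :=
        card_le_card_of_injOn Prod.snd (fun _ _ => mem_univ _) fun i hi j hj hij => by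
          obtain ⟨-, hqi, hiq⟩ := mem_filter.1 hi
          obtain ⟨-, hqj, hjq⟩ := mem_filter.1 hj
          exact Prod.ext (le_antisymm (not_lt.1 (hnot_lt _ _ hqj hiq))
            (not_lt.1 (hnot_lt _ _ hqi hjq))) hij
    _ = b := card_fin b

lemma sum_five_pow_mul_add_le (m b a e : ℕ) :
    ((∑ j : Fin m × Fin b, (5 ^ (j.1 : ℕ) * a + e) : ℕ) : ℝ) ≤ b * (5 ^ m / 4 * (a + e)) := by
  have hgeom : ∑ i ∈ range m, (5 : ℝ) ^ i ≤ 5 ^ m / 4 := by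
    rw [geom_sum_eq (by norm_num)]
    linarith
  push_cast
  calc ∑ j : Fin m × Fin b, ((5 : ℝ) ^ (j.1 : ℕ) * a + e)
      ≤ ∑ j : Fin m × Fin b, (5 : ℝ) ^ (j.1 : ℕ) * (a + e) := by
        refine sum_le_sum fun j _ => ?_
        rw [mul_add]
        gcongr
        exact le_mul_of_one_le_left e.cast_nonneg (one_le_pow₀ (by norm_num))
    _ = b * ((∑ i ∈ range m, (5 : ℝ) ^ i) * (a + e)) := by
        rw [Fintype.sum_prod_type, Finset.sum_range, sum_mul, mul_sum]
        simp
    _ ≤ b * (5 ^ m / 4 * (a + e)) := by gcongr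

lemma exists_five_pow_le_log_le {y : ℝ} (hy : 2 < y) :
    ∃ m : ℕ, (5 : ℝ) ^ m ≤ 16 / 5 * y ∧ Real.log y ≤ 4 * m := by
  obtain ⟨m, hmy, hym⟩ :=
    exists_nat_pow_near (x := 16 / 5 * y) (y := 5) (by linarith) (by norm_num)
  refine ⟨m, hmy, ?_⟩
  have hm : (1 : ℝ) ≤ m := by
    rcases m.eq_zero_or_pos with rfl | hm
    · norm_num at hym
      linarith
    · exact_mod_cast hm
  have hlog_five : Real.log 5 ≤ 2 := by
    rw [Real.log_le_iff_le_exp (by norm_num), ← one_add_one_eq_two, Real.exp_add]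
    nlinarith [Real.exp_one_gt_d9]
  have hlog : Real.log y ≤ (m + 1 : ℕ) * Real.log 5 := by
    rw [← Real.log_pow]
    exact Real.log_le_log (by linarith) (by linarith)
  push_cast at hlog
  nlinarith

variable {X : Type*} [Fintype X] [Nonempty X] [DecidableEq X] [MeasurableSpace X]
  [MeasurableSingletonClass X] {ε : ℝ}

lemma exists_ranges_of_sum_le {m b a e : ℕ} (he : ((2 * e : ℕ) : ℝ) < ε * Fintype.card X)
    (ha : ε * Fintype.card X ≤ a)
    (hsum : ∑ j : Fin m × Fin b, (5 ^ (j.1 : ℕ) * a + e) ≤ Fintype.card X) :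
    ∃ 𝓡 : Finset (Finset X), 𝓡.vcDim ≤ e + 1 ∧
      doublingConstant (uniformOn Set.univ) 𝓡 ε ≤ b + 1 ∧
      ∀ S : Finset X, IsEpsNet (uniformOn Set.univ) 𝓡 ε S → m * b * (e + 1) ≤ #S := by
  have ha0 : 0 < a := by
    have : (0 : ℝ) < a := ((Nat.cast_nonneg _).trans_lt he).trans_le ha
    exact_mod_cast this
  obtain ⟨G, hG, hcard⟩ := exists_pairwise_disjoint_card_eq hsum
  refine ⟨blockRanges G fun j => 5 ^ (j.1 : ℕ) * a, vcDim_blockRanges_le hG hcard,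
    doublingConstant_blockRanges_le hcard he (card_filter_five_pow_mul_le ha0 m b),
    fun S hS => ?_⟩
  have hheavy : ∀ R ∈ blockRanges G fun j => 5 ^ (j.1 : ℕ) * a,
      ε ≤ (uniformOn (Set.univ : Set X)).real (R : Set X) := fun R hR => by
    obtain ⟨j, -, hRcard⟩ := mem_blockRanges.1 hR
    rw [measureReal_uniformOn_univ, hRcard,
      le_div_iff₀ (by exact_mod_cast Fintype.card_pos (α := X))]
    exact ha.trans (Nat.cast_le.2 (Nat.le_mul_of_pos_left a (by positivity)))
  simpa only [Fintype.card_prod, Fintype.card_fin] using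
    card_mul_le_card_of_forall_inter_nonempty hG hcard fun R hR => hS.2 R hR (hheavy R hR)

lemma exists_ranges_forall_isEpsNet_card_ge_of_pos {d : ℕ} {D : ℝ} (hd : 0 < d)
    (hε : (d : ℝ) / Fintype.card X < ε) (hD : 2 ≤ D) (hDε : D < 1 / (2 * ε)) :
    ∃ 𝓡 : Finset (Finset X), 𝓡.vcDim ≤ d ∧
      (doublingConstant (uniformOn Set.univ) 𝓡 ε : ℝ) ≤ D ∧
      ∀ S : Finset X, IsEpsNet (uniformOn Set.univ) 𝓡 ε S →
        1 / 32 * (d * D * Real.log (1 / (ε * D))) ≤ #S := by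
  have hN : (0 : ℝ) < Fintype.card X := by exact_mod_cast Fintype.card_pos
  have hd1 : (1 : ℝ) ≤ d := by exact_mod_cast hd
  have hε0 : 0 < ε := lt_of_le_of_lt (by positivity) hε
  rw [div_lt_iff₀ hN] at hε
  rw [lt_div_iff₀ (by positivity)] at hDε
  have hy : 2 < 1 / (ε * D) := by
    rw [lt_div_iff₀ (by positivity)]
    linarith
  obtain ⟨m, hm, hlog⟩ := exists_five_pow_le_log_le hy
  set a := ⌈ε * Fintype.card X⌉₊
  set b := ⌊D / 2⌋₊
  set e := d / 2
  have hb : (b : ℝ) ≤ D / 2 := Nat.floor_le (by linarith)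
  have he2 : ((2 * e : ℕ) : ℝ) ≤ d := Nat.cast_le.2 (by omega)
  have hae : (a : ℝ) + e ≤ 5 / 2 * (ε * Fintype.card X) := by
    push_cast at he2
    linarith [Nat.ceil_lt_add_one (show 0 ≤ ε * Fintype.card X by positivity)]
  have hsum : ∑ j : Fin m × Fin b, (5 ^ (j.1 : ℕ) * a + e) ≤ Fintype.card X := by
    rw [← Nat.cast_le (α := ℝ)]
    calc _ ≤ (b : ℝ) * (5 ^ m / 4 * (a + e)) := sum_five_pow_mul_add_le m b a e
      _ ≤ D / 2 * (16 / 5 * (1 / (ε * D)) / 4 * (5 / 2 * (ε * Fintype.card X))) := by gcongr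
      _ = Fintype.card X := by field_simp; norm_num
  obtain ⟨𝓡, hvc, hdoubling, hnet⟩ :=
    exists_ranges_of_sum_le (ε := ε) (he2.trans_lt hε) (Nat.le_ceil _) hsum
  refine ⟨𝓡, by omega, (Nat.cast_le.2 hdoubling).trans (by push_cast; linarith), fun S hS => ?_⟩
  have hb' : D ≤ 4 * b := by
    linarith [Nat.div_two_lt_floor (show 1 ≤ D / 2 by linarith)]
  have he' : (d : ℝ) ≤ 2 * (e + 1) := by exact_mod_cast (by omega : d ≤ 2 * (e + 1))
  calc 1 / 32 * (d * D * Real.log (1 / (ε * D)))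
      ≤ 1 / 32 * (2 * (e + 1) * (4 * b) * (4 * m)) := by
        have := Real.log_nonneg (one_le_two.trans hy.le)
        gcongr
    _ = (m * b * (e + 1) : ℕ) := by push_cast; ring
    _ ≤ #S := Nat.cast_le.2 (hnet S hS)

lemma exists_ranges_forall_isEpsNet_card_ge {d : ℕ} {D : ℝ}
    (hε : (d : ℝ) / Fintype.card X < ε) (hD : 2 ≤ D) (hDε : D < 1 / (2 * ε)) :
    ∃ 𝓡 : Finset (Finset X), 𝓡.vcDim ≤ d ∧
      (doublingConstant (uniformOn Set.univ) 𝓡 ε : ℝ) ≤ D ∧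
      ∀ S : Finset X, IsEpsNet (uniformOn Set.univ) 𝓡 ε S →
        1 / 32 * (d * D * Real.log (1 / (ε * D))) ≤ #S := by
  rcases d.eq_zero_or_pos with rfl | hd
  · have hdoubling : doublingConstant (uniformOn (Set.univ : Set X)) ∅ ε ≤ 0 :=
      doublingConstant_le fun r _ 𝓠 h𝓠 _ => by
        rw [Nat.le_zero, card_eq_zero, ← subset_empty]
        exact h𝓠.trans (rangesLE_subset _ ∅ _)
    refine ⟨∅, by simp [vcDim, shatterer], ?_, by simp⟩
    rw [Nat.le_zero.1 hdoubling, Nat.cast_zero]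
    linarith
  · exact exists_ranges_forall_isEpsNet_card_ge_of_pos hd hε hD hDε

end LowerBound

end RangeSpace

theorem theorem4_general :
    (∃ C : ℝ, 0 < C ∧
      ∀ (X : Type*) [DecidableEq X] [MeasurableSpace X] [MeasurableSingletonClass X]
        (P : Measure X) [IsProbabilityMeasure P] (𝓡 : Finset (Finset X)) (d : ℕ) (ε D : ℝ)
        (τ : ℝ → ℝ),
        𝓡.vcDim ≤ d → 0 < ε → (RangeSpace.doublingConstant P 𝓡 ε : ℝ) ≤ D →
        AntitoneOn τ (Set.Ioi 0) → (∀ s, 0 < s → RangeSpace.capacity P 𝓡 s ≤ τ s) →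
        2 * τ (2 * ε) ≤ D →
        ∃ S : Finset X, RangeSpace.IsEpsNet P 𝓡 ε S ∧
          (S.card : ℝ) ≤ C * ∑ i ∈ Finset.Icc 1 (RangeSpace.numScales ε),
            (Real.log (D / τ (2 ^ i * ε)) + d) * τ (2 ^ i * ε)) ∧
    (∃ C : ℝ, 0 < C ∧
      ∀ (X : Type*) [DecidableEq X] [MeasurableSpace X] [MeasurableSingletonClass X]
        (P : Measure X) [IsProbabilityMeasure P] (𝓡 : Finset (Finset X)) (d : ℕ) (ε D : ℝ),
        𝓡.vcDim ≤ d → 1 ≤ d → 0 < ε → (RangeSpace.doublingConstant P 𝓡 ε : ℝ) ≤ D →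
        D ≤ 1 / (2 * ε) →
        ∃ S : Finset X, RangeSpace.IsEpsNet P 𝓡 ε S ∧
          (S.card : ℝ) ≤ C * (d * D * Real.log (1 / (ε * D)))) ∧
    (∃ c : ℝ, 0 < c ∧
      ∀ (n d : ℕ) (ε D : ℝ), 0 < n → (d : ℝ) / n < ε → 2 ≤ D → D < 1 / (2 * ε) →
        ∃ 𝓡 : Finset (Finset (Fin n)),
          𝓡.vcDim ≤ d ∧
          (RangeSpace.doublingConstant
            (ProbabilityTheory.uniformOn (Set.univ : Set (Fin n))) 𝓡 ε : ℝ) ≤ D ∧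
          ∀ S : Finset (Fin n),
            RangeSpace.IsEpsNet (ProbabilityTheory.uniformOn (Set.univ : Set (Fin n))) 𝓡 ε S →
            c * (d * D * Real.log (1 / (ε * D))) ≤ S.card) := by
  refine ⟨⟨240, by norm_num, fun X _ _ _ P _ 𝓡 d ε D τ hd hε hD hτ hcap hτD => ?_⟩,
    ⟨1440, by norm_num, fun X _ _ _ P _ 𝓡 d ε D hd hd1 hε hD hDε => ?_⟩,
    ⟨1 / 32, by norm_num, fun n d ε D hn hε hD hDε => ?_⟩⟩
  · exact RangeSpace.exists_isEpsNet_of_capacity_le hd hε hD hτ hcap hτD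
  · exact RangeSpace.exists_isEpsNet_of_doublingConstant_le hd hd1 hε hD hDε
  · have : Nonempty (Fin n) := ⟨⟨0, hn⟩⟩
    exact RangeSpace.exists_ranges_forall_isEpsNet_card_ge (by rwa [Fintype.card_fin]) hD hDε

theorem theorem4 :
    -- (i), for the capacity itself as well as for the capacity cut off at `1`
    (∃ C : ℝ, 0 < C ∧
      ∀ (X : Type*) [Fintype X] [DecidableEq X] [MeasurableSpace X] [MeasurableSingletonClass X]
        (P : Measure X) [IsProbabilityMeasure P] (𝓡 : Finset (Finset X)) (d : ℕ) (ε D : ℝ)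
        (τ : ℝ → ℝ),
        𝓡.vcDim ≤ d → 0 < ε → (RangeSpace.doublingConstant P 𝓡 ε : ℝ) ≤ D →
        (τ = RangeSpace.capacity P 𝓡 ∨ τ = RangeSpace.truncCapacity P 𝓡) →
        2 * τ (2 * ε) ≤ D →
        ∃ S : Finset X, RangeSpace.IsEpsNet P 𝓡 ε S ∧
          (S.card : ℝ) ≤ C * ∑ i ∈ Finset.Icc 1 (RangeSpace.numScales ε),
            (Real.log (D / τ (2 ^ i * ε)) + d) * τ (2 ^ i * ε)) ∧
    -- (ii), upper bound
    (∃ C : ℝ, 0 < C ∧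
      ∀ (X : Type*) [Fintype X] [DecidableEq X] [MeasurableSpace X] [MeasurableSingletonClass X]
        (P : Measure X) [IsProbabilityMeasure P] (𝓡 : Finset (Finset X)) (d : ℕ) (ε D : ℝ),
        𝓡.vcDim ≤ d → 1 ≤ d → 0 < ε → (RangeSpace.doublingConstant P 𝓡 ε : ℝ) ≤ D →
        D ≤ 1 / (2 * ε) →
        ∃ S : Finset X, RangeSpace.IsEpsNet P 𝓡 ε S ∧
          (S.card : ℝ) ≤ C * (d * D * Real.log (1 / (ε * D)))) ∧
    -- (ii), lower bound
    (∃ c : ℝ, 0 < c ∧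
      ∀ (n d : ℕ) (ε D : ℝ), 0 < n → (d : ℝ) / n < ε → 2 ≤ D → D < 1 / (2 * ε) →
        ∃ 𝓡 : Finset (Finset (Fin n)),
          𝓡.vcDim ≤ d ∧
          (RangeSpace.doublingConstant
            (ProbabilityTheory.uniformOn (Set.univ : Set (Fin n))) 𝓡 ε : ℝ) ≤ D ∧
          ∀ S : Finset (Fin n),
            RangeSpace.IsEpsNet (ProbabilityTheory.uniformOn (Set.univ : Set (Fin n))) 𝓡 ε S →
            c * (d * D * Real.log (1 / (ε * D))) ≤ S.card) := by
  obtain ⟨⟨C, hC, hcapacity⟩, ⟨C', hC', hdoubling⟩, hlower⟩ := theorem4_general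
  refine ⟨⟨C, hC, ?_⟩, ⟨C', hC', fun X _ => hdoubling X⟩, hlower⟩
  rintro X _ _ _ _ P _ 𝓡 d ε D _ hd hε hD (rfl | rfl) hτD
  · exact hcapacity X P 𝓡 d ε D _ hd hε hD (RangeSpace.antitoneOn_capacity P 𝓡)
      (fun _ _ => le_rfl) hτD
  · exact hcapacity X P 𝓡 d ε D _ hd hε hD (RangeSpace.antitoneOn_truncCapacity P 𝓡)
      (fun _ _ => le_max_left _ _) hτD
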